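/- **Conventions.** Slopes on the torus are the elements of $\mathbb{Q}\cup\{1/0\}$, with geometric intersection number $i(a/b,c/d)=|ad-bc|$. The Farey triangulation of $\mathbb{H}^2$ has an edge between any two slopes with intersection number $1$. Let $p,q,r$ be slopes spanning a Farey triangle $T_0$, let $m$ be a slope, and let $(T_0,T_1,\dots,T_N)$ be the sequence of Farey triangles crossed by the geodesic from the centre of $T_0$ to the ideal point $m$, so that $m$ is a vertex of $T_N$ and of no earlier triangle. Assume $N\ge 2$. The *layered solid torus* $T$ with boundary slopes $p,q,r$ and meridian $m$ is the ideal triangulation with $N-1$ tetrahedra obtained as follows. Start with the once-punctured torus triangulated by the edges of slopes $p,q,r$. For $k=1,\dots,N-1$ layer on a tetrahedron effecting the diagonal exchange from $T_{k-1}$ to $T_k$. Finally fold the two triangles of the innermost torus, which is triangulated by $T_{N-1}$, onto each other across the edge whose slope does not belong to $T_N$; this makes $m$ homotopically trivial. An *angle structure* on $T$ assigns a dihedral angle to every edge of every tetrahedron so that opposite edges of a tetrahedron have equal angles, all angles lie in $(0,\pi)$, the three angles at each ideal vertex of each tetrahedron sum to $\pi$, and the angles around each interior edge of $T$ sum to $2\pi$.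 The interior dihedral angle at a boundary edge is the sum of the angles of the tetrahedra at that edge, and its exterior angle is $\pi$ minus the interior one. **Proposition.** Let $p,q,r,m$ be as above with $N\ge 2$ (that is, $m$ is separated from the triangle $pqr$ by at least one Farey triangle), and label $p,q,r$ so that $r$ is the first of these slopes to disappear from the sequence and $p$ the second: $T_1=\{p,q,r'\}$ with $r'\neq r$, and $p\notin T_2$. Let $\theta_p,\theta_q,\theta_r$ be real numbers with $$\theta_p+\theta_q+\theta_r=\pi,\qquad -\pi<\theta_p,\theta_q<\pi,\qquad 0<\theta_r<\pi .$$ Then the layered solid torus $T$ with boundary slopes $p,q,r$ and meridian $m$ admits an angle structure whose interior dihedral angles at the boundary edges of slopes $p,q,r$ are $\pi-\theta_p$, $\pi-\theta_q$, $\pi-\theta_r$, respectively, if and only if $$ i(m,p)\,\theta_p+i(m,q)\,\theta_q+i(m,r)\,\theta_r>2\pi .$$ -/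

import Mathlib

/-! ### Slopes and the Farey triangulation -/

/-- Slopes on the (once-punctured) torus: the points of `ℚ ∪ {1/0}`. -/
abbrev Slope : Type := OnePoint ℚ

instance instDecidableEqSlope : DecidableEq Slope := inferInstanceAs (DecidableEq (Option ℚ))

namespace Slope

/-- The primitive lattice vector `(a, b)` of the slope `a/b` in lowest terms, with `b > 0`, or
`(1, 0)` for the slope `1/0`. -/
def vec (s : Slope) : ℤ × ℤ := s.elim (1, 0) (fun x => (x.num, (x.den : ℤ)))

/-- The slope `a/b` of a non-zero lattice vector `(a, b)`. -/
def ofVec (v : ℤ × ℤ) : Slope :=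
  if v.2 = 0 then OnePoint.infty else OnePoint.some ((v.1 : ℚ) / (v.2 : ℚ))

/-- Geometric intersection number `i(a/b, c/d) = |ad - bc|`. -/
def inter (s t : Slope) : ℕ := (s.vec.1 * t.vec.2 - s.vec.2 * t.vec.1).natAbs

end Slope

/-- Three slopes spanning a triangle of the Farey triangulation. -/
def IsFareyTriangle (T : Finset Slope) : Prop :=
  T.card = 3 ∧ ∀ s ∈ T, ∀ t ∈ T, s ≠ t → Slope.inter s t = 1

/-- The sequence of Farey triangles `T₀, T₁, …, T_N` met by the geodesic from the centre of `T₀` to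
the ideal point `m`: consecutive triangles share an edge, the path never turns back, and `T_N` is
the first (and only) triangle of the sequence with the vertex `m`.  As the dual graph of the Farey
triangulation is a tree, these conditions determine the sequence.  Only the values `tri i` with
`i ≤ N` matter. -/
structure FareyPath (T₀ : Finset Slope) (m : Slope) where
  length : ℕ
  tri : ℕ → Finset Slope
  tri_zero : tri 0 = T₀
  isFareyTriangle : ∀ i ≤ length, IsFareyTriangle (tri i)
  card_inter : ∀ i < length, (tri i ∩ tri (i + 1)).card = 2
  ne_of_two_steps : ∀ i, i + 2 ≤ length → tri (i + 2) ≠ tri i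
  mem_iff : ∀ i ≤ length, (m ∈ tri i ↔ i = length)

namespace Slope

theorem isCoprime_vec (s : Slope) : IsCoprime s.vec.1 s.vec.2 := by
  induction s using OnePoint.rec with
  | infty => exact isCoprime_one_left
  | coe x => exact Int.isCoprime_iff_gcd_eq_one.2 x.reduced

theorem inter_self (s : Slope) : inter s s = 0 := by
  simp [inter, mul_comm]

theorem inter_comm (s t : Slope) : inter s t = inter t s := by
  unfold inter
  rw [← Int.natAbs_neg]
  congr 1
  ring

theorem eq_of_inter_eq_zero {s t : Slope} (h : inter s t = 0) : s = t := by
  unfold inter at h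
  rw [Int.natAbs_eq_zero, sub_eq_zero] at h
  induction s using OnePoint.rec with
  | infty =>
    induction t using OnePoint.rec with
    | infty => rfl
    | coe y => exact absurd h (by simp [vec])
  | coe x =>
    induction t using OnePoint.rec with
    | infty => exact absurd h (by
        simp only [vec, OnePoint.elim_some, OnePoint.elim_infty]
        have := x.den_nz
        omega)
    | coe y =>
      simp only [vec, OnePoint.elim_some] at h
      congr 1
      rw [Rat.eq_iff_mul_eq_mul]
      linarith

/-- A primitive vector is, up to sign, the vector of its slope. -/
theorem vec_ofVec {v : ℤ × ℤ} (h : IsCoprime v.1 v.2) : (ofVec v).vec = v ∨ (ofVec v).vec = -v := by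
  obtain ⟨a, b⟩ := v
  simp only at h
  by_cases hb : b = 0
  · subst hb
    rcases Int.isUnit_iff.1 (isCoprime_zero_right.1 h) with rfl | rfl <;> simp [ofVec, vec]
  · have h2 : ofVec (a, b) = OnePoint.some ((a : ℚ) / (b : ℚ)) := by simp [ofVec, hb]
    rw [h2]
    have hc : Nat.Coprime a.natAbs b.natAbs := Int.isCoprime_iff_gcd_eq_one.1 h
    rcases lt_or_gt_of_ne hb with hlt | hgt
    · right
      have h3 : (a : ℚ) / (b : ℚ) = ((-a : ℤ) : ℚ) / ((-b : ℤ) : ℚ) := by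
        push_cast; rw [neg_div_neg_eq]
      have hc' : Nat.Coprime (-a).natAbs (-b).natAbs := by simpa using hc
      rw [h3]
      simp only [vec, OnePoint.elim_some]
      rw [Rat.num_div_eq_of_coprime (by omega) hc', Rat.den_div_eq_of_coprime (by omega) hc']
      rfl
    · left
      simp only [vec, OnePoint.elim_some]
      rw [Rat.num_div_eq_of_coprime hgt hc, Rat.den_div_eq_of_coprime hgt hc]

end Slope

theorem IsFareyTriangle.descent_aux {a b c m : Slope} (hab : Slope.inter a b = 1)
    (hac : Slope.inter a c = 1) (hbc : Slope.inter b c = 1)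
    (ha : Slope.inter a m ≠ 0) (hb : Slope.inter b m ≠ 0)
    (h : Slope.inter c m = Slope.inter a m + Slope.inter b m) :
    ∃ c', Slope.inter a c' = 1 ∧ Slope.inter b c' = 1 ∧ Slope.inter c' m < Slope.inter c m := by
  have key : ∃ e f : ℤ, (e = 1 ∨ e = -1) ∧ (f = 1 ∨ f = -1) ∧
      c.vec = (e * a.vec.1 + f * b.vec.1, e * a.vec.2 + f * b.vec.2) := by
    unfold Slope.inter at hab hac hbc
    set D := a.vec.1 * b.vec.2 - a.vec.2 * b.vec.1 with hD
    have hD1 : D * D = 1 := by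
      rcases Int.natAbs_eq_iff.1 hab with h | h <;> rw [h] <;> norm_num
    have hDu : D = 1 ∨ D = -1 := by simpa using Int.natAbs_eq_iff.1 hab
    refine ⟨-D * (b.vec.1 * c.vec.2 - b.vec.2 * c.vec.1),
      D * (a.vec.1 * c.vec.2 - a.vec.2 * c.vec.1), ?_, ?_, ?_⟩
    · rcases Int.natAbs_eq_iff.1 hbc with h | h <;> rw [h] <;> rcases hDu with h | h <;> simp [h]
    · rcases Int.natAbs_eq_iff.1 hac with h | h <;> rw [h] <;> rcases hDu with h | h <;> simp [h]
    · ext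
      · linear_combination (-c.vec.1) * hD1 + D * c.vec.1 * hD
      · linear_combination (-c.vec.2) * hD1 + D * c.vec.2 * hD
  obtain ⟨e, f, he, hf, hv⟩ := key
  have hdet : a.vec.1 * b.vec.2 - a.vec.2 * b.vec.1 = 1 ∨
      a.vec.1 * b.vec.2 - a.vec.2 * b.vec.1 = -1 := by
    simpa using Int.natAbs_eq_iff.1 hab
  set v : ℤ × ℤ := (e * a.vec.1 - f * b.vec.1, e * a.vec.2 - f * b.vec.2) with hvdef
  have hav : a.vec.1 * v.2 - a.vec.2 * v.1 =
      -f * (a.vec.1 * b.vec.2 - a.vec.2 * b.vec.1) := by simp only [hvdef]; ring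
  have hbv : b.vec.1 * v.2 - b.vec.2 * v.1 =
      -e * (a.vec.1 * b.vec.2 - a.vec.2 * b.vec.1) := by simp only [hvdef]; ring
  have hcop : IsCoprime v.1 v.2 := by
    rcases hf with rfl | rfl <;> rcases hdet with h1 | h1 <;> rw [h1] at hav
    · exact ⟨a.vec.2, -a.vec.1, by linarith⟩
    · exact ⟨-a.vec.2, a.vec.1, by linarith⟩
    · exact ⟨-a.vec.2, a.vec.1, by linarith⟩
    · exact ⟨a.vec.2, -a.vec.1, by linarith⟩
  refine ⟨Slope.ofVec v, ?_, ?_, ?_⟩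
  · have : (a.vec.1 * v.2 - a.vec.2 * v.1).natAbs = 1 := by
      rw [hav]; rcases hf with rfl | rfl <;> rcases hdet with h1 | h1 <;> rw [h1] <;> rfl
    rcases Slope.vec_ofVec hcop with h1 | h1 <;> simp only [Slope.inter, h1, Prod.fst_neg, Prod.snd_neg]
    · exact this
    · rw [← this, ← Int.natAbs_neg]; congr 1; ring
  · have : (b.vec.1 * v.2 - b.vec.2 * v.1).natAbs = 1 := by
      rw [hbv]; rcases he with rfl | rfl <;> rcases hdet with h1 | h1 <;> rw [h1] <;> rfl
    rcases Slope.vec_ofVec hcop with h1 | h1 <;> simp only [Slope.inter, h1, Prod.fst_neg, Prod.snd_neg]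
    · exact this
    · rw [← this, ← Int.natAbs_neg]; congr 1; ring
  · have h0 : Slope.inter (Slope.ofVec v) m = (v.1 * m.vec.2 - v.2 * m.vec.1).natAbs := by
      rcases Slope.vec_ofVec hcop with h1 | h1 <;>
        simp only [Slope.inter, h1, Prod.fst_neg, Prod.snd_neg]
      rw [← Int.natAbs_neg]; congr 1; ring
    rw [h0]
    have hvm : v.1 * m.vec.2 - v.2 * m.vec.1 = e * (a.vec.1 * m.vec.2 - a.vec.2 * m.vec.1) -
        f * (b.vec.1 * m.vec.2 - b.vec.2 * m.vec.1) := by simp only [hvdef]; ring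
    have hcm : c.vec.1 * m.vec.2 - c.vec.2 * m.vec.1 =
        e * (a.vec.1 * m.vec.2 - a.vec.2 * m.vec.1) +
        f * (b.vec.1 * m.vec.2 - b.vec.2 * m.vec.1) := by rw [hv]; ring
    unfold Slope.inter at ha hb h ⊢
    rw [hvm]
    rw [hcm] at h ⊢
    rcases he with rfl | rfl <;> rcases hf with rfl | rfl <;> omega

theorem isFareyTriangle_of {a b c : Slope} (hab : Slope.inter a b = 1)
    (hac : Slope.inter a c = 1) (hbc : Slope.inter b c = 1) : IsFareyTriangle {a, b, c} := by
  have ne : ∀ {s t : Slope}, Slope.inter s t = 1 → s ≠ t := by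
    rintro s t h rfl
    rw [Slope.inter_self] at h
    exact absurd h (by norm_num)
  refine ⟨Finset.card_eq_three.2 ⟨a, b, c, ne hab, ne hac, ne hbc, rfl⟩, ?_⟩
  intro s hs t ht hst
  simp only [Finset.mem_insert, Finset.mem_singleton] at hs ht
  have hba := Slope.inter_comm a b ▸ hab
  have hca := Slope.inter_comm a c ▸ hac
  have hcb := Slope.inter_comm b c ▸ hbc
  rcases hs with rfl | rfl | rfl <;> rcases ht with rfl | rfl | rfl <;>
    first | assumption | exact absurd rfl hst

/-- One step towards `m`. -/
theorem IsFareyTriangle.descent {T : Finset Slope} (hT : IsFareyTriangle T) {m : Slope}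
    (hm : m ∉ T) : ∃ T', IsFareyTriangle T' ∧ (T ∩ T').card = 2 ∧
      ∑ s ∈ T', Slope.inter s m < ∑ s ∈ T, Slope.inter s m := by
  have main : ∀ a b c : Slope, T = {a, b, c} → a ≠ b → a ≠ c → b ≠ c →
      Slope.inter c m = Slope.inter a m + Slope.inter b m →
      ∃ T', IsFareyTriangle T' ∧ (T ∩ T').card = 2 ∧
      ∑ s ∈ T', Slope.inter s m < ∑ s ∈ T, Slope.inter s m := by
    rintro a b c rfl nab nac nbc h
    have ne0 : ∀ s ∈ ({a, b, c} : Finset Slope), Slope.inter s m ≠ 0 := by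
      intro s hs h0
      exact hm (Slope.eq_of_inter_eq_zero h0 ▸ hs)
    have hab := hT.2 a (by simp) b (by simp) nab
    obtain ⟨c', h1, h2, h3⟩ := IsFareyTriangle.descent_aux hab
      (hT.2 a (by simp) c (by simp) nac) (hT.2 b (by simp) c (by simp) nbc)
      (ne0 a (by simp)) (ne0 b (by simp)) h
    have nac' : a ≠ c' := by
      rintro rfl; rw [Slope.inter_self] at h1; exact absurd h1 (by norm_num)
    have nbc' : b ≠ c' := by
      rintro rfl; rw [Slope.inter_self] at h2; exact absurd h2 (by norm_num)
    have ncc' : c ≠ c' := by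
      intro hcc; rw [hcc] at h3; exact lt_irrefl _ h3
    refine ⟨{a, b, c'}, isFareyTriangle_of hab h1 h2, ?_, ?_⟩
    · have : ({a, b, c} ∩ {a, b, c'} : Finset Slope) = {a, b} := by
        ext x
        simp only [Finset.mem_inter, Finset.mem_insert, Finset.mem_singleton]
        constructor
        · rintro ⟨hx | hx | hx, hy⟩
          · exact Or.inl hx
          · exact Or.inr hx
          · rcases hy with hy | hy | hy
            · exact Or.inl hy
            · exact Or.inr hy
            · exact absurd (hx.symm.trans hy) ncc'
        · tauto
      rw [this, Finset.card_pair nab]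
    · rw [Finset.sum_insert (by simp [nab, nac']), Finset.sum_insert (by simp [nbc']),
        Finset.sum_singleton, Finset.sum_insert (by simp [nab, nac]),
        Finset.sum_insert (by simp [nbc]), Finset.sum_singleton]
      omega
  obtain ⟨a, b, c, nab, nac, nbc, hTe⟩ := Finset.card_eq_three.1 hT.1
  have hab := hT.2 a (by simp [hTe]) b (by simp [hTe]) nab
  have hac := hT.2 a (by simp [hTe]) c (by simp [hTe]) nac
  have hbc := hT.2 b (by simp [hTe]) c (by simp [hTe]) nbc
  have hcases : Slope.inter c m = Slope.inter a m + Slope.inter b m ∨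
      Slope.inter b m = Slope.inter a m + Slope.inter c m ∨
      Slope.inter a m = Slope.inter b m + Slope.inter c m := by
    unfold Slope.inter at hab hac hbc ⊢
    have pl : (a.vec.1 * b.vec.2 - a.vec.2 * b.vec.1) * (c.vec.1 * m.vec.2 - c.vec.2 * m.vec.1) -
        (a.vec.1 * c.vec.2 - a.vec.2 * c.vec.1) * (b.vec.1 * m.vec.2 - b.vec.2 * m.vec.1) +
        (b.vec.1 * c.vec.2 - b.vec.2 * c.vec.1) * (a.vec.1 * m.vec.2 - a.vec.2 * m.vec.1) = 0 := by
      ring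
    rcases Int.natAbs_eq_iff.1 hab with h1 | h1 <;> rcases Int.natAbs_eq_iff.1 hac with h2 | h2 <;>
      rcases Int.natAbs_eq_iff.1 hbc with h3 | h3 <;> rw [h1, h2, h3] at pl <;> push_cast at pl <;>
      omega
  rcases hcases with h | h | h
  · exact main a b c hTe nab nac nbc h
  · exact main a c b (by rw [hTe]; congr 1; exact Finset.pair_comm b c) nac nab nbc.symm h
  · exact main b c a (by rw [hTe]; ext; simp; tauto) nbc nab.symm nac.symm h

/-- The Farey path from a triangle to a slope always exists. -/
theorem FareyPath.nonempty {T₀ : Finset Slope} (hT : IsFareyTriangle T₀) (m : Slope) :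
    Nonempty (FareyPath T₀ m) := by
  suffices H : ∀ n : ℕ, ∀ T : Finset Slope, IsFareyTriangle T → ∑ s ∈ T, Slope.inter s m = n →
      ∃ γ : FareyPath T m, ∀ i < γ.length,
        ∑ s ∈ γ.tri (i + 1), Slope.inter s m < ∑ s ∈ γ.tri i, Slope.inter s m from
    let ⟨γ, _⟩ := H _ T₀ hT rfl
    ⟨γ⟩
  intro n
  induction n using Nat.strong_induction_on with
  | _ n ih =>
    intro T hT hn
    by_cases hm : m ∈ T
    · refine ⟨⟨0, fun _ => T, rfl, fun _ _ => hT, by simp, by simp, ?_⟩, by simp⟩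
      intro i hi
      simp [hm, Nat.le_zero.1 hi]
    · obtain ⟨T', hT', hcard, hlt⟩ := hT.descent hm
      obtain ⟨γ, hγ⟩ := ih _ (hn ▸ hlt) T' hT' rfl
      have hdec : ∀ i < γ.length + 1,
          ∑ s ∈ (fun i => Nat.casesOn i T γ.tri : ℕ → Finset Slope) (i + 1), Slope.inter s m <
          ∑ s ∈ (fun i => Nat.casesOn i T γ.tri : ℕ → Finset Slope) i, Slope.inter s m := by
        rintro (_ | i) hi
        · simpa [γ.tri_zero] using hlt
        · exact hγ i (by omega)
      refine ⟨⟨γ.length + 1, fun i => Nat.casesOn i T γ.tri, rfl, ?_, ?_, ?_, ?_⟩, hdec⟩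
      · rintro (_ | i) hi
        · exact hT
        · exact γ.isFareyTriangle i (by omega)
      · rintro (_ | i) hi
        · simpa [γ.tri_zero] using hcard
        · exact γ.card_inter i (by omega)
      · intro i hi h
        have h1 := hdec i (by omega)
        have h2 := hdec (i + 1) (by omega)
        have h3 : ∑ s ∈ (fun i => Nat.casesOn i T γ.tri : ℕ → Finset Slope) (i + 1 + 1),
            Slope.inter s m =
            ∑ s ∈ (fun i => Nat.casesOn i T γ.tri : ℕ → Finset Slope) i, Slope.inter s m :=
          congrArg (fun S : Finset Slope => ∑ s ∈ S, Slope.inter s m) h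
        rw [h3] at h2
        exact lt_asymm h1 h2
      · rintro (_ | i) hi
        · simp [hm]
        · have := γ.mem_iff i (by omega)
          simpa using this

/-! ### Ideal triangulations and angle structures -/

/-- An edge of a model tetrahedron with vertex set `Fin 4`: a pair of vertices. -/
abbrev TetEdge : Type := {e : Finset (Fin 4) // e.card = 2}

namespace TetEdge

/-- The opposite edge. -/
def opp (e : TetEdge) : TetEdge :=
  ⟨e.1ᶜ, by rw [Finset.card_compl, e.2, Fintype.card_fin]⟩

/-- The image of an edge under a relabelling of the vertices. -/
def map (σ : Equiv.Perm (Fin 4)) (e : TetEdge) : TetEdge :=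
  ⟨e.1.map σ.toEmbedding, by rw [Finset.card_map, e.2]⟩

end TetEdge

/-- An ideal triangulation with tetrahedra indexed by `ι`.  Face `f` of a tetrahedron is the face
opposite to its vertex `f`.  `glue t f = none` means that face `f` of `t` lies in the boundary;
`glue t f = some (t', σ)` means that face `f` of `t` is glued to face `σ f` of `t'`, each vertex
`v ≠ f` of the first face going to the vertex `σ v` of the second. -/
structure IdealTriangulation (ι : Type) where
  glue : ι → Fin 4 → Option (ι × Equiv.Perm (Fin 4))
  glue_symm : ∀ t f t' σ, glue t f = some (t', σ) → glue t' (σ f) = some (t, σ⁻¹)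
  glue_ne : ∀ t f t' σ, glue t f = some (t', σ) → (t', σ f) ≠ (t, f)

namespace IdealTriangulation

variable {ι : Type} (τ : IdealTriangulation ι)

/-- Two edges of tetrahedra are identified by a face gluing. -/
def EdgeStep (x y : ι × TetEdge) : Prop :=
  ∃ f σ, f ∉ x.2.1 ∧ τ.glue x.1 f = some (y.1, σ) ∧ y.2 = x.2.map σ

/-- The edges of the triangulation: classes of edges of tetrahedra under the equivalence relation
generated by the face gluings. -/
def Edge : Type := Quot τ.EdgeStep

/-- The edge of the triangulation that is the image of the edge `e` of the tetrahedron `t`. -/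
def edge (t : ι) (e : TetEdge) : τ.Edge := Quot.mk _ (t, e)

/-- An edge lies in the boundary if it is an edge of some boundary face. -/
def IsBoundaryEdge (E : τ.Edge) : Prop :=
  ∃ t e f, τ.edge t e = E ∧ f ∉ e.1 ∧ τ.glue t f = none

open Classical in
/-- The sum of the dihedral angles `α` of all tetrahedra around an edge of the triangulation. -/
noncomputable def angleSum [Fintype ι] (α : ι → TetEdge → ℝ) (E : τ.Edge) : ℝ :=
  ∑ t : ι, ∑ e : TetEdge, if τ.edge t e = E then α t e else 0

/-- Angle structures: `α t e` is the dihedral angle of the tetrahedron `t` at its edge `e`. -/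
structure IsAngleStructure [Fintype ι] (α : ι → TetEdge → ℝ) : Prop where
  opp : ∀ t e, α t e.opp = α t e
  pos : ∀ t e, 0 < α t e
  lt_pi : ∀ t e, α t e < Real.pi
  vertex : ∀ t v, ∑ e : TetEdge with v ∈ e.1, α t e = Real.pi
  interior : ∀ E : τ.Edge, ¬ τ.IsBoundaryEdge E → τ.angleSum α E = 2 * Real.pi

end IdealTriangulation

/-! ### Layered solid tori

The tetrahedron `Δ` effecting a diagonal exchange is a thickened parallelogram in the torus
`ℝ² / ℤ²`.  If `u, w` is a basis of `ℤ²`, its vertices `0, 1, 2, 3` lie over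
`0, u, u + w, w`.  The outer faces (those opposite to the vertices `0` and `2`) contain the diagonal
of direction `u - w` that is covered, and the inner faces (those opposite to `1` and `3`) contain the
new diagonal of direction `u + w`.  Next, either the side `u` or the side `w` is exchanged, and the
basis of the next tetrahedron is `(u + w, w)` or `(u, u + w)` respectively. -/

namespace LayeredSolidTorus

/-- The gluing of face `f` of a tetrahedron across the torus between two consecutive tetrahedra:
inner faces `1, 3` of one and outer faces `0, 2` of the next.  It is induced by a translation of the
torus; `d` tells whether the side `u` of the outer tetrahedron is the one exchanged by the inner one
(otherwise it is the side `w`).  For example, if `d` holds then the vertices `0, u, u + w` of face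
`3` are translated by `w` to the vertices `w`, `u + w`, `(u + w) + w` of face `0` of the next
tetrahedron. -/
def layer (d : Bool) (f : Fin 4) : Equiv.Perm (Fin 4) :=
  if d then (if f = 0 ∨ f = 3 then Equiv.swap 0 3 else Equiv.swap 1 2)
  else (if f = 0 ∨ f = 1 then Equiv.swap 0 1 else Equiv.swap 2 3)

/-- Folding of the innermost torus: the inner face `3` is folded onto the inner face `1` across the
side `u` (if `d`) or `w` (otherwise).  This side is translated to its parallel copy in the other
face, and the third vertex goes to the third vertex: `0 ↦ 3, 1 ↦ 2, 2 ↦ 0` for `u`, and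
`1 ↦ 0, 2 ↦ 3, 0 ↦ 2` for `w`. -/
def fold (d : Bool) : Equiv.Perm (Fin 4) :=
  if d then ⟨![3, 2, 0, 1], ![2, 3, 1, 0], by decide, by decide⟩
  else ⟨![2, 0, 3, 1], ![1, 3, 0, 2], by decide, by decide⟩

/-- The face gluings of `n` tetrahedra layered on each other, the last one being folded up; `d k`
tells which side of the `k`-th tetrahedron is the next one to be exchanged or, for the last
tetrahedron, to be folded across (`true` for `u`, `false` for `w`). -/
def glue (n : ℕ) (d : ℕ → Bool) (k : Fin n) (f : Fin 4) :
    Option (Fin n × Equiv.Perm (Fin 4)) :=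
  if f = 0 ∨ f = 2 then
    if 0 < k.1 then some (⟨k.1 - 1, by omega⟩, layer (d (k.1 - 1)) f) else none
  else
    if h : k.1 + 1 < n then some (⟨k.1 + 1, h⟩, layer (d k.1) f)
    else some (k, if f = 3 then fold (d k.1) else (fold (d k.1))⁻¹)

theorem layer_spec : ∀ d f, (layer d f)⁻¹ = layer d f ∧ layer d (layer d f f) = layer d f ∧
    (layer d f f = 0 ∨ layer d f f = 2 ↔ ¬ (f = 0 ∨ f = 2)) := by
  decide

theorem fold_spec : ∀ d, fold d 3 = 1 ∧ (fold d)⁻¹ 1 = 3 := by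
  decide

theorem glue_symm (n : ℕ) (d : ℕ → Bool) (t : Fin n) (f : Fin 4) (t' : Fin n)
    (σ : Equiv.Perm (Fin 4)) (h : glue n d t f = some (t', σ)) :
    glue n d t' (σ f) = some (t, σ⁻¹) := by
  obtain ⟨t, ht⟩ := t
  by_cases hf : f = 0 ∨ f = 2
  · by_cases h0 : 0 < t
    · simp only [glue, hf, h0, if_true, Option.some.injEq, Prod.mk.injEq] at h
      obtain ⟨rfl, rfl⟩ := h
      obtain ⟨h1, h2, h3⟩ := layer_spec (d (t - 1)) f
      have h4 : ¬ (layer (d (t - 1)) f f = 0 ∨ layer (d (t - 1)) f f = 2) := by tauto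
      have h5 : t - 1 + 1 < n := by omega
      have h6 : t - 1 + 1 = t := by omega
      simp only [glue, h4, if_false, h6, ht, dif_pos, h2, h1]
    · simp [glue, hf, h0] at h
  · by_cases hn : t + 1 < n
    · simp only [glue, hf, hn, if_false, dif_pos, Option.some.injEq, Prod.mk.injEq] at h
      obtain ⟨rfl, rfl⟩ := h
      obtain ⟨h1, h2, h3⟩ := layer_spec (d t) f
      have h4 : layer (d t) f f = 0 ∨ layer (d t) f f = 2 := by tauto
      simp only [glue, h4, if_true, Nat.succ_pos, Nat.add_sub_cancel, h2, h1]
    · simp only [glue, hf, hn, if_false, dite_false, Option.some.injEq, Prod.mk.injEq] at h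
      obtain ⟨rfl, rfl⟩ := h
      obtain ⟨h1, h2⟩ := fold_spec (d t)
      have h13 : f = 1 ∨ f = 3 := by
        revert hf; revert f; decide
      rcases h13 with rfl | rfl
      · simp [glue, h2, hn]
      · simp [glue, h1, hn]

theorem glue_ne (n : ℕ) (d : ℕ → Bool) (t : Fin n) (f : Fin 4) (t' : Fin n)
    (σ : Equiv.Perm (Fin 4)) (h : glue n d t f = some (t', σ)) : (t', σ f) ≠ (t, f) := by
  obtain ⟨t, ht⟩ := t
  by_cases hf : f = 0 ∨ f = 2
  · by_cases h0 : 0 < t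
    · simp only [glue, hf, h0, if_true, Option.some.injEq, Prod.mk.injEq] at h
      obtain ⟨rfl, rfl⟩ := h
      simp only [ne_eq, Prod.mk.injEq, Fin.mk.injEq, not_and]
      omega
    · simp [glue, hf, h0] at h
  · by_cases hn : t + 1 < n
    · simp only [glue, hf, hn, if_false, dif_pos, Option.some.injEq, Prod.mk.injEq] at h
      obtain ⟨rfl, rfl⟩ := h
      simp
    · simp only [glue, hf, hn, if_false, dite_false, Option.some.injEq, Prod.mk.injEq] at h
      obtain ⟨rfl, rfl⟩ := h
      obtain ⟨h1, h2⟩ := fold_spec (d t)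
      have h13 : f = 1 ∨ f = 3 := by
        revert hf; revert f; decide
      rcases h13 with rfl | rfl
      · simp [h2]
      · simp [h1]

/-- The triangulation consisting of `n` layered tetrahedra, folded up at the end. -/
def triangulation (n : ℕ) (d : ℕ → Bool) : IdealTriangulation (Fin n) where
  glue := glue n d
  glue_symm := glue_symm n d
  glue_ne := glue_ne n d

variable {m : Slope}

/-- Bases `(u, w)` of `ℤ²` for the successive tetrahedra along a Farey path whose initial triangle has
the vertices `p, q, r` and which leaves it through the edge `pq`.  The `k`-th tetrahedron
(`k = 0, 1, …`) effects the exchange from the triangle `T_k` to the triangle `T_{k+1}`: the slopes of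
`u` and `w` are those common to both, the slope of `u - w` is the one removed and that of `u + w` the
new one. -/
def frame (p q r : Slope) (γ : FareyPath {p, q, r} m) : ℕ → (ℤ × ℤ) × (ℤ × ℤ)
  | 0 => if Slope.ofVec (p.vec - q.vec) = r then (p.vec, q.vec) else (p.vec, -q.vec)
  | k + 1 =>
    let b := frame p q r γ k
    if Slope.ofVec b.1 ∈ γ.tri (k + 2) then (b.1, b.1 + b.2) else (b.1 + b.2, b.2)

/-- Whether the side `u` of the `k`-th tetrahedron is the next slope to disappear. -/
def dropsU (p q r : Slope) (γ : FareyPath {p, q, r} m) (k : ℕ) : Bool :=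
  decide (Slope.ofVec (frame p q r γ k).1 ∉ γ.tri (k + 2))

/-- The lattice point over which a vertex of the `k`-th tetrahedron lies. -/
def pos (p q r : Slope) (γ : FareyPath {p, q, r} m) (k : ℕ) : Fin 4 → ℤ × ℤ :=
  let b := frame p q r γ k
  ![0, b.1, b.1 + b.2, b.2]

/-- The edge `e` of the `k`-th tetrahedron has slope `s`. -/
def HasSlope (p q r : Slope) (γ : FareyPath {p, q, r} m) (k : ℕ) (e : TetEdge) (s : Slope) : Prop :=
  ∃ i j, i ≠ j ∧ e.1 = {i, j} ∧ Slope.ofVec (pos p q r γ k j - pos p q r γ k i) = s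

end LayeredSolidTorus

open LayeredSolidTorus in
/-- The layered solid torus with boundary slopes `p, q, r` and meridian `m`, where the Farey path `γ`
from the triangle `pqr` to `m` leaves this triangle through the edge `pq`: one tetrahedron for each of
the exchanges `T₀ → T₁ → ⋯ → T_{N-1}`, the triangulated torus `T_{N-1}` being folded across its
slope that is not in `T_N`. -/
def layeredSolidTorus (p q r : Slope) {m : Slope} (γ : FareyPath {p, q, r} m) :
    IdealTriangulation (Fin (γ.length - 1)) :=
  triangulation (γ.length - 1) (dropsU p q r γ)

/-- With the dihedral angles `α`, the interior dihedral angle of the layered solid torus at its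
boundary edge of slope `s` is `a`. -/
def HasBoundaryAngle (p q r : Slope) {m : Slope} (γ : FareyPath {p, q, r} m)
    (α : Fin (γ.length - 1) → TetEdge → ℝ) (s : Slope) (a : ℝ) : Prop :=
  ∀ t e f, f ∉ e.1 → (layeredSolidTorus p q r γ).glue t f = none →
    LayeredSolidTorus.HasSlope p q r γ t e s →
    (layeredSolidTorus p q r γ).angleSum α ((layeredSolidTorus p q r γ).edge t e) = a

/-! An angle structure is recorded by the exterior angles of the successive tori met when the
tetrahedra are peeled off from the outside. Equality of opposite angles leaves the `k`-th
tetrahedron with angles `x` at the sides `u`, `y` at the sides `w`, and `z` at both diagonals. If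
the torus outside it has exterior angles `A, B, C` at `u, w, u - w`, then `z = π - C`, so `x + y =
C`; the torus inside has exterior angles `A + 2x`, `B + 2y` and, because the angles around the new
edge `u + w` sum to `2π`, `-C`. Their total stays `π`. The final fold requires exterior angle `π` at
the side folded across. This is `IsPleating`.

Weight each exterior angle by the intersection number of its slope with `m`. One step inward lowers
the weighted sum by twice the product of `i(m, u + w)` and the angle at the surviving side, a
positive amount. On the folded torus the weights are `1, 1, 2` and the sum is exactly `2π`. This
proves necessity (`IsPleating.two_pi_lt`).

For sufficiency the angles are chosen from the outside inward. As long as the tetrahedron is not the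
last, an interval of choices keeps the next torus within the required bounds and its weighted sum
above `2π` (`exists_angle`); for the last one the fold dictates the angles, and the inequality says
that they are positive.

Two translations remain: the weights are computed from lattice bases along the Farey path
(`inter_meridian`), and the edge classes of the gluing are classified by integer labels
(`edge_eq_iff`), which turns angle sums into sums over tetrahedra. -/

namespace Slope

/-! ### Slopes and bases of the lattice -/

theorem ofVec_neg (v : ℤ × ℤ) : ofVec (-v) = ofVec v := by
  by_cases h : v.2 = 0
  · simp [ofVec, h]
  · simp [ofVec, h, neg_div_neg_eq]

theorem ofVec_vec (s : Slope) : ofVec s.vec = s := by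
  induction s using OnePoint.rec with
  | infty => simp [ofVec, vec]
  | coe x =>
    have h : (x.den : ℤ) ≠ 0 := by exact_mod_cast x.den_nz
    simp only [ofVec, vec, OnePoint.elim_some, h, if_false]
    congr 1
    exact_mod_cast x.num_div_den

theorem inter_ofVec (s : Slope) {v : ℤ × ℤ} (hv : IsCoprime v.1 v.2) :
    inter s (ofVec v) = (s.vec.1 * v.2 - s.vec.2 * v.1).natAbs := by
  rcases vec_ofVec hv with h | h <;> simp only [inter, h, Prod.fst_neg, Prod.snd_neg]
  rw [← Int.natAbs_neg]; congr 1; ring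

/-- Two vectors form a basis of the lattice `ℤ²`. -/
def IsLatticeBasis (v w : ℤ × ℤ) : Prop := IsUnit (v.1 * w.2 - v.2 * w.1)

namespace IsLatticeBasis

variable {v w : ℤ × ℤ}

theorem of_inter {s t : Slope} (h : inter s t = 1) : IsLatticeBasis s.vec t.vec :=
  Int.isUnit_iff_natAbs_eq.2 h

theorem neg_right (h : IsLatticeBasis v w) : IsLatticeBasis v (-w) := by
  have : v.1 * (-w).2 - v.2 * (-w).1 = -(v.1 * w.2 - v.2 * w.1) := by
    simp only [Prod.fst_neg, Prod.snd_neg]; ring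
  rw [IsLatticeBasis, this]
  exact IsUnit.neg h

theorem add_right (h : IsLatticeBasis v w) : IsLatticeBasis v (v + w) := by
  have : v.1 * (v + w).2 - v.2 * (v + w).1 = v.1 * w.2 - v.2 * w.1 := by
    simp only [Prod.fst_add, Prod.snd_add]; ring
  rwa [IsLatticeBasis, this]

theorem add_left (h : IsLatticeBasis v w) : IsLatticeBasis (v + w) w := by
  have : (v + w).1 * w.2 - (v + w).2 * w.1 = v.1 * w.2 - v.2 * w.1 := by
    simp only [Prod.fst_add, Prod.snd_add]; ring
  rwa [IsLatticeBasis, this]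

theorem isCoprime_left (h : IsLatticeBasis v w) : IsCoprime v.1 v.2 := by
  rcases Int.isUnit_iff.1 h with h | h
  · exact ⟨w.2, -w.1, by linarith⟩
  · exact ⟨-w.2, w.1, by linarith⟩

theorem isCoprime_right (h : IsLatticeBasis v w) : IsCoprime w.1 w.2 := by
  rcases Int.isUnit_iff.1 h with h | h
  · exact ⟨-v.2, v.1, by linarith⟩
  · exact ⟨v.2, -v.1, by linarith⟩

theorem inter_eq_one (h : IsLatticeBasis v w) : inter (ofVec v) (ofVec w) = 1 := by
  rw [inter_ofVec _ h.isCoprime_right]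
  have h' := Int.isUnit_iff_natAbs_eq.1 h
  rcases vec_ofVec h.isCoprime_left with h1 | h1 <;> rw [h1]
  · exact h'
  · rw [← h', ← Int.natAbs_neg]
    simp only [Prod.fst_neg, Prod.snd_neg]
    congr 1; ring

theorem ofVec_ne (h : IsLatticeBasis v w) : ofVec v ≠ ofVec w := by
  intro heq
  have h1 := h.inter_eq_one
  rw [heq, inter_self] at h1
  exact absurd h1 (by norm_num)

theorem sub_right (h : IsLatticeBasis v w) : IsLatticeBasis v (v - w) := by
  rw [sub_eq_add_neg]; exact h.neg_right.add_right

theorem sub_left (h : IsLatticeBasis v w) : IsLatticeBasis (v - w) w := by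
  have : (v - w).1 * w.2 - (v - w).2 * w.1 = v.1 * w.2 - v.2 * w.1 := by
    simp only [Prod.fst_sub, Prod.snd_sub]; ring
  rwa [IsLatticeBasis, this]

/-- The common neighbours of two slopes spanning a Farey edge. -/
theorem eq_of_inter (h : IsLatticeBasis v w) {s : Slope} (hv : inter s (ofVec v) = 1)
    (hw : inter s (ofVec w) = 1) : s = ofVec (v + w) ∨ s = ofVec (v - w) := by
  rw [inter_ofVec _ h.isCoprime_left] at hv
  rw [inter_ofVec _ h.isCoprime_right] at hw
  have key : s.vec = v + w ∨ s.vec = -(v + w) ∨ s.vec = v - w ∨ s.vec = -(v - w) := by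
    obtain ⟨a, b⟩ := v
    obtain ⟨c, d⟩ := w
    generalize s.vec = z at *
    obtain ⟨x, y⟩ := z
    simp only [IsLatticeBasis] at h hv hw
    have hD := Int.isUnit_iff.1 h
    -- Cramer's rule: all three determinants are `±1`, hence so are both coordinates in the basis.
    have e1 : x * (a * d - b * c) = c * (-(x * b - y * a)) + a * (x * d - y * c) := by ring
    have e2 : y * (a * d - b * c) = d * (-(x * b - y * a)) + b * (x * d - y * c) := by ring
    simp only [Prod.mk_add_mk, Prod.neg_mk, Prod.mk_sub_mk, Prod.mk.injEq]
    rcases hD with h0 | h0 <;> rcases Int.natAbs_eq_iff.1 hv with h1 | h1 <;>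
      rcases Int.natAbs_eq_iff.1 hw with h2 | h2 <;> rw [h0, h1, h2] at e1 e2 <;>
      push_cast at e1 e2 <;> omega
  rw [← ofVec_vec s]
  rcases key with h | h | h | h <;> rw [h] <;> simp only [ofVec_neg, true_or, or_true]

end IsLatticeBasis

end Slope

/-! ### Farey triangles in terms of lattice bases -/

open Slope

/-- A Farey edge lies on only two triangles, because the third vertex is a common neighbour of both
ends and `eq_of_inter` lists these. -/
theorem IsFareyTriangle.eq_insert {T : Finset Slope} (hT : IsFareyTriangle T) {v w : ℤ × ℤ}
    (h : IsLatticeBasis v w) (hv : ofVec v ∈ T) (hw : ofVec w ∈ T) :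
    T = {ofVec v, ofVec w, ofVec (v + w)} ∨ T = {ofVec v, ofVec w, ofVec (v - w)} := by
  have hcard : 0 < ((T.erase (ofVec v)).erase (ofVec w)).card := by
    rw [Finset.card_erase_of_mem (Finset.mem_erase.2 ⟨h.ofVec_ne.symm, hw⟩),
      Finset.card_erase_of_mem hv, hT.1]
    norm_num
  obtain ⟨x, hx⟩ := Finset.card_pos.1 hcard
  simp only [Finset.mem_erase] at hx
  obtain ⟨hxw, hxv, hxT⟩ := hx
  have hTx : T = {ofVec v, ofVec w, x} := by
    symm
    apply Finset.eq_of_subset_of_card_le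
    · intro y hy
      simp only [Finset.mem_insert, Finset.mem_singleton] at hy
      rcases hy with rfl | rfl | rfl <;> assumption
    · rw [hT.1, Finset.card_eq_three.2 ⟨_, _, _, h.ofVec_ne, hxv.symm, hxw.symm, rfl⟩]
  rcases h.eq_of_inter (hT.2 x hxT _ hv hxv) (hT.2 x hxT _ hw hxw) with rfl | rfl
  · exact Or.inl hTx
  · exact Or.inr hTx

theorem Finset.mem_of_card_triple_inter {α : Type*} [DecidableEq α] {a b c : α} {T : Finset α}
    (h : (({a, b, c} : Finset α) ∩ T).card = 2) :
    a ∈ T ∧ b ∈ T ∨ a ∈ T ∧ c ∈ T ∨ b ∈ T ∧ c ∈ T := by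
  by_contra hc
  have hle : (({a, b, c} : Finset α) ∩ T).card ≤ 1 := by
    rw [Finset.card_le_one]
    intro x hx y hy
    simp only [Finset.mem_inter, Finset.mem_insert, Finset.mem_singleton] at hx hy
    obtain ⟨rfl | rfl | rfl, hx'⟩ := hx <;> obtain ⟨rfl | rfl | rfl, hy'⟩ := hy <;> tauto
  omega

/-! ### Bases along the Farey path and intersection numbers with the meridian -/

namespace LayeredSolidTorus

/-- The intersection numbers of the meridian with the slopes of the sides `u` and `w` of the first
of `n` layered tetrahedra. -/
def weight : ℕ → (ℕ → Bool) → ℕ × ℕ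
  | 0, _ => (1, 1)
  | n + 1, d =>
    let a := weight n fun k => d (k + 1)
    if d 0 then (a.1 + a.2, a.2) else (a.1, a.1 + a.2)

/-- A basis `(u, w)` is adapted to the exchange from the triangle `T` to the triangle `T'`. -/
structure IsAdapted (b : (ℤ × ℤ) × (ℤ × ℤ)) (T T' : Finset Slope) : Prop where
  basis : IsLatticeBasis b.1 b.2
  outer : T = {ofVec b.1, ofVec b.2, ofVec (b.1 - b.2)}
  inner : T' = {ofVec b.1, ofVec b.2, ofVec (b.1 + b.2)}

variable {p q r m : Slope}

/-- The slopes `p` and `q` have only two common neighbours, so a sign of the second vector can be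
chosen that makes the difference, not the sum, have slope `r`. -/
theorem frame_zero_spec (hpqr : IsFareyTriangle {p, q, r}) (γ : FareyPath {p, q, r} m) :
    (frame p q r γ 0).1 = p.vec ∧ ofVec (frame p q r γ 0).2 = q ∧
    ofVec ((frame p q r γ 0).1 - (frame p q r γ 0).2) = r ∧
    IsLatticeBasis (frame p q r γ 0).1 (frame p q r γ 0).2 := by
  have hne : p ≠ q ∧ p ≠ r ∧ q ≠ r := by
    have hc := hpqr.1
    refine ⟨?_, ?_, ?_⟩ <;> rintro rfl
    · have := Finset.card_le_two (a := p) (b := r)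
      simp at hc; omega
    · have := Finset.card_le_two (a := p) (b := q)
      rw [Finset.pair_comm q p] at hc
      simp at hc; omega
    · have := Finset.card_le_two (a := p) (b := q)
      simp at hc; omega
  obtain ⟨hpq, hpr, hqr⟩ := hne
  have h := IsLatticeBasis.of_inter (hpqr.2 p (by simp) q (by simp) hpq)
  have h1 := hpqr.2 r (by simp) p (by simp) hpr.symm
  have h2 := hpqr.2 r (by simp) q (by simp) hqr.symm
  rw [← ofVec_vec p] at h1
  rw [← ofVec_vec q] at h2
  have h3 := h.eq_of_inter h1 h2
  unfold frame
  split_ifs with h4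
  · exact ⟨rfl, ofVec_vec q, h4, h⟩
  · refine ⟨rfl, (ofVec_neg _).trans (ofVec_vec q), ?_, h.neg_right⟩
    rw [sub_neg_eq_add]
    rcases h3 with h3 | h3
    · exact h3.symm
    · exact absurd h3.symm h4

/-- The path neither pauses nor turns back, so it cannot keep both `u` and `w`: the only triangles
on that edge are the two just visited. It therefore keeps `u + w` and exactly one side; the side
lost is, up to sign, the difference of the next basis. -/
theorem isAdapted_frame (hpqr : IsFareyTriangle {p, q, r}) (γ : FareyPath {p, q, r} m)
    (hr : r ∉ γ.tri 1) : ∀ k < γ.length,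
    IsAdapted (frame p q r γ k) (γ.tri k) (γ.tri (k + 1)) := by
  intro k
  induction k with
  | zero =>
    intro hk
    obtain ⟨h1, h2, h3, hb⟩ := frame_zero_spec hpqr γ
    have h1' : ofVec (frame p q r γ 0).1 = p := by rw [h1, ofVec_vec]
    have hT := γ.card_inter 0 hk
    rw [γ.tri_zero] at hT
    have hmem : p ∈ γ.tri 1 ∧ q ∈ γ.tri 1 := by
      rcases Finset.mem_of_card_triple_inter hT with h | h | h
      · exact h
      · exact absurd h.2 hr
      · exact absurd h.2 hr
    refine ⟨hb, by rw [γ.tri_zero, h1', h2, h3], ?_⟩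
    rcases (γ.isFareyTriangle 1 hk).eq_insert hb (by rw [h1']; exact hmem.1)
      (by rw [h2]; exact hmem.2) with h | h
    · exact h
    · exact absurd (by rw [h, h3]; simp) hr
  | succ k ih =>
    intro hk
    obtain ⟨hb, ho, hi⟩ := ih (by omega)
    have hF := γ.isFareyTriangle (k + 2) hk
    have hne := γ.ne_of_two_steps k hk
    have hcard := γ.card_inter (k + 1) hk
    have hne' : γ.tri (k + 2) ≠ γ.tri (k + 1) := by
      intro h
      rw [h, Finset.inter_self, (γ.isFareyTriangle (k + 1) hk.le).1] at hcard
      norm_num at hcard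
    have hmem := hcard
    rw [hi] at hmem
    have hmem := Finset.mem_of_card_triple_inter hmem
    have hnot : ¬ (ofVec (frame p q r γ k).1 ∈ γ.tri (k + 2) ∧
        ofVec (frame p q r γ k).2 ∈ γ.tri (k + 2)) := by
      rintro ⟨h1, h2⟩
      rcases hF.eq_insert hb h1 h2 with h | h
      · exact hne' (h.trans hi.symm)
      · exact hne (h.trans ho.symm)
    rw [frame]
    generalize frame p q r γ k = b at *
    obtain ⟨u, w⟩ := b
    simp only at *
    split_ifs with hu
    · have huw : ofVec (u + w) ∈ γ.tri (k + 2) := by tauto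
      refine ⟨hb.add_right, ?_, ?_⟩
      · rw [hi, show u - (u + w) = -w by abel, ofVec_neg]
        ext; simp; tauto
      · rcases hF.eq_insert hb.add_right hu huw with h | h
        · exact h
        · exact absurd ⟨hu, by rw [h, show u - (u + w) = -w by abel, ofVec_neg]; simp⟩ hnot
    · have huw : ofVec (u + w) ∈ γ.tri (k + 2) ∧ ofVec w ∈ γ.tri (k + 2) := by tauto
      refine ⟨hb.add_left, ?_, ?_⟩
      · rw [hi, show (u + w) - w = u by abel]
        ext; simp; tauto
      · rcases hF.eq_insert hb.add_left huw.1 huw.2 with h | h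
        · exact h
        · exact absurd (by rw [h, show (u + w) - w = u by abel]; simp) hu

/-- The meridian in terms of the bases of the tetrahedra. -/
theorem vec_meridian (hpqr : IsFareyTriangle {p, q, r}) (γ : FareyPath {p, q, r} m)
    (hr : r ∉ γ.tri 1) (j : ℕ) : ∀ k, k + j + 1 = γ.length →
    ∃ ε : ℤ, IsUnit ε ∧ m.vec =
      (ε * (((weight j fun i => dropsU p q r γ (k + i)).2 : ℤ) * (frame p q r γ k).1.1 +
        ((weight j fun i => dropsU p q r γ (k + i)).1 : ℤ) * (frame p q r γ k).2.1),
      ε * (((weight j fun i => dropsU p q r γ (k + i)).2 : ℤ) * (frame p q r γ k).1.2 +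
        ((weight j fun i => dropsU p q r γ (k + i)).1 : ℤ) * (frame p q r γ k).2.2)) := by
  induction j with
  | zero =>
    intro k hk
    -- Here `k = N - 1`, one beyond the last tetrahedron: `m` is the vertex gained in the exchange
    -- from `T_{N-1}` to `T_N`, hence `±(u + w)`.
    obtain ⟨hb, ho, hi⟩ := isAdapted_frame hpqr γ hr k (by omega)
    have h1 := (γ.mem_iff (k + 1) (by omega)).2 (by omega)
    have h2 : m ∉ γ.tri k := fun h => by
      have := (γ.mem_iff k (by omega)).1 h
      omega
    have hm : m = ofVec ((frame p q r γ k).1 + (frame p q r γ k).2) := by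
      rw [hi] at h1
      rw [ho] at h2
      simp only [Finset.mem_insert, Finset.mem_singleton] at h1 h2
      tauto
    simp only [weight]
    rcases vec_ofVec hb.add_right.isCoprime_right with h | h
    · exact ⟨1, isUnit_one, (congrArg vec hm).trans (h.trans (by ext <;> simp))⟩
    · exact ⟨-1, isUnit_one.neg, (congrArg vec hm).trans (h.trans (by ext <;> simp))⟩
  | succ j ih =>
    intro k hk
    obtain ⟨ε, hε, h⟩ := ih (k + 1) (by omega)
    -- The sign is unchanged; expressing the next basis in the present one reproduces the recursion
    -- of `weight`.
    refine ⟨ε, hε, ?_⟩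
    rw [h]
    have hsh : (fun i => dropsU p q r γ (k + 1 + i)) =
        fun i => dropsU p q r γ (k + (i + 1)) := by
      funext i; congr 1; ring
    rw [hsh, weight]
    simp only [add_zero]
    generalize weight j (fun i => dropsU p q r γ (k + (i + 1))) = a
    by_cases hu : ofVec (frame p q r γ k).1 ∈ γ.tri (k + 2)
    · have hd : dropsU p q r γ k = false := by simpa [dropsU] using hu
      rw [hd, frame]
      simp only [hu, if_true, Bool.false_eq_true, if_false]
      ext <;> simp only [Prod.fst_add, Prod.snd_add] <;> push_cast <;> ring
    · have hd : dropsU p q r γ k = true := by simpa [dropsU] using hu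
      rw [hd, frame]
      simp only [hu, if_false, if_true]
      ext <;> simp only [Prod.fst_add, Prod.snd_add] <;> push_cast <;> ring

/-- With `a` the weights, `m = ±(a.2 u + a.1 w)`, whose determinants with `u`, `w`, `u - w` are
`a.1`, `a.2`, `a.1 + a.2` up to sign. -/
theorem inter_meridian (hpqr : IsFareyTriangle {p, q, r}) (γ : FareyPath {p, q, r} m)
    (hN : 1 ≤ γ.length) (hr : r ∉ γ.tri 1) :
    inter m p = (weight (γ.length - 1) (dropsU p q r γ)).1 ∧
    inter m q = (weight (γ.length - 1) (dropsU p q r γ)).2 ∧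
    inter m r = (weight (γ.length - 1) (dropsU p q r γ)).1 +
      (weight (γ.length - 1) (dropsU p q r γ)).2 := by
  obtain ⟨ε, hε, h⟩ := vec_meridian hpqr γ hr (γ.length - 1) 0 (by omega)
  obtain ⟨h1, h2, h3, hb⟩ := frame_zero_spec hpqr γ
  simp only [zero_add] at h
  generalize weight (γ.length - 1) (dropsU p q r γ) = a at *
  have h1' : ofVec (frame p q r γ 0).1 = p := by rw [h1, ofVec_vec]
  generalize frame p q r γ 0 = b at *
  obtain ⟨⟨u1, u2⟩, ⟨w1, w2⟩⟩ := b
  simp only at *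
  have hε' := Int.isUnit_iff_natAbs_eq.1 hε
  have hb' := Int.isUnit_iff_natAbs_eq.1 hb
  simp only at hb'
  have hcalc : ∀ (x y : ℤ × ℤ) (t : ℤ), x.1 * y.2 - x.2 * y.1 = ε * t * (u1 * w2 - u2 * w1) →
      (x.1 * y.2 - x.2 * y.1).natAbs = t.natAbs := by
    intro x y t hxy
    rw [hxy, Int.natAbs_mul, Int.natAbs_mul, hε', hb']
    simp
  refine ⟨?_, ?_, ?_⟩
  · rw [← h1', inter_ofVec _ hb.isCoprime_left, hcalc _ _ (-(a.1 : ℤ)) (by rw [h]; ring)]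
    simp
  · rw [← h2, inter_ofVec _ hb.isCoprime_right, hcalc _ _ (a.2 : ℤ) (by rw [h]; ring)]
    simp
  · rw [← h3, inter_ofVec _ hb.sub_right.isCoprime_right,
      hcalc _ _ (-((a.1 + a.2 : ℕ) : ℤ)) (by rw [h]; push_cast; simp only [Prod.mk_sub_mk]; ring)]
    rw [Int.natAbs_neg, Int.natAbs_natCast]

end LayeredSolidTorus

/-! ### Exterior angles of the successive tori -/

namespace LayeredSolidTorus

/-- The exterior angles `A k, B k, C k` of the `k`-th torus at the slopes of `u`, `w` and `u - w`, for
`n` layered tetrahedra, where the `k`-th tetrahedron has the angles `x k` at `u`, `y k` at `w` and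
`π - C k` at the diagonals. -/
structure IsPleating (n : ℕ) (d : ℕ → Bool) (x y A B C : ℕ → ℝ) : Prop where
  x_pos : ∀ k < n, 0 < x k
  y_pos : ∀ k < n, 0 < y k
  x_add_y : ∀ k < n, x k + y k = C k
  lt_pi : ∀ k < n, C k < Real.pi
  sum_eq : A 0 + B 0 + C 0 = Real.pi
  step_true : ∀ k < n, d k = true →
    A (k + 1) = -C k ∧ B (k + 1) = B k + 2 * y k ∧ C (k + 1) = A k + 2 * x k
  step_false : ∀ k < n, d k = false →
    A (k + 1) = A k + 2 * x k ∧ B (k + 1) = -C k ∧ C (k + 1) = B k + 2 * y k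
  last : C n = Real.pi

variable {n : ℕ} {d : ℕ → Bool} {x y A B C : ℕ → ℝ}

/-- The total `π` survives the removal of a tetrahedron, since the gain `2x + 2y = 2C` makes up for
replacing `C` by `-C`. -/
theorem IsPleating.tail (h : IsPleating (n + 1) d x y A B C) :
    IsPleating n (fun k => d (k + 1)) (fun k => x (k + 1)) (fun k => y (k + 1))
      (fun k => A (k + 1)) (fun k => B (k + 1)) (fun k => C (k + 1)) where
  x_pos k hk := h.x_pos (k + 1) (by omega)
  y_pos k hk := h.y_pos (k + 1) (by omega)
  x_add_y k hk := h.x_add_y (k + 1) (by omega)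
  lt_pi k hk := h.lt_pi (k + 1) (by omega)
  sum_eq := by
    have h1 := h.sum_eq
    have h2 := h.x_add_y 0 (by omega)
    cases hd : d 0 with
    | true =>
      obtain ⟨e1, e2, e3⟩ := h.step_true 0 (by omega) hd
      rw [e1, e2, e3]; linarith
    | false =>
      obtain ⟨e1, e2, e3⟩ := h.step_false 0 (by omega) hd
      rw [e1, e2, e3]; linarith
  step_true k hk := h.step_true (k + 1) (by omega)
  step_false k hk := h.step_false (k + 1) (by omega)
  last := h.last

theorem IsPleating.sum_eq_pi (h : IsPleating n d x y A B C) {k : ℕ} (hk : k ≤ n) :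
    A k + B k + C k = Real.pi := by
  induction k generalizing n d x y A B C with
  | zero => exact h.sum_eq
  | succ k ih =>
    obtain ⟨n, rfl⟩ : ∃ n', n = n' + 1 := ⟨n - 1, by omega⟩
    exact ih h.tail (by omega)

theorem weight_pos (n : ℕ) (d : ℕ → Bool) : 0 < (weight n d).1 ∧ 0 < (weight n d).2 := by
  induction n generalizing d with
  | zero => simp [weight]
  | succ n ih =>
    have := ih fun k => d (k + 1)
    rw [weight]
    split_ifs <;> simp only <;> omega

/-- Strictness fails when no tetrahedron is left, the weights being `(1, 1)`. This is why the last
tetrahedron is treated apart in `exists_isPleating`. -/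
theorem two_lt_weight_add (n : ℕ) (d : ℕ → Bool) :
    2 < (weight (n + 1) d).1 + (weight (n + 1) d).2 := by
  have := weight_pos n fun k => d (k + 1)
  rw [weight]
  split_ifs <;> simp only <;> omega

/-- The quantity compared with `2π`. -/
noncomputable def slopeSum (n : ℕ) (d : ℕ → Bool) (a b c : ℝ) : ℝ :=
  (weight n d).1 * a + (weight n d).2 * b + ((weight n d).1 + (weight n d).2) * c

/-- The loss `2 * P * y`, with `P` the weight of the new slope `u + w` and `y` the angle at the
surviving side `w`, is what makes the weighted sum decrease inward. -/
theorem slopeSum_succ_true (hd : d 0 = true) (a b x y : ℝ) :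
    slopeSum (n + 1) d a b (x + y) =
    slopeSum n (fun k => d (k + 1)) (-(x + y)) (b + 2 * y) (a + 2 * x) +
      2 * (weight n fun k => d (k + 1)).1 * y := by
  simp only [slopeSum, weight, hd, if_true]
  push_cast
  ring

theorem slopeSum_succ_false (hd : d 0 = false) (a b x y : ℝ) :
    slopeSum (n + 1) d a b (x + y) =
    slopeSum n (fun k => d (k + 1)) (a + 2 * x) (-(x + y)) (b + 2 * y) +
      2 * (weight n fun k => d (k + 1)).2 * x := by
  simp only [slopeSum, weight, hd]
  push_cast
  simp
  ring

theorem IsPleating.slopeSum_tail_lt (h : IsPleating (n + 1) d x y A B C) :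
    slopeSum n (fun k => d (k + 1)) (A 1) (B 1) (C 1) < slopeSum (n + 1) d (A 0) (B 0) (C 0) := by
  obtain ⟨w1, w2⟩ := weight_pos n fun k => d (k + 1)
  have w1' : (0 : ℝ) < (weight n fun k => d (k + 1)).1 := by exact_mod_cast w1
  have w2' : (0 : ℝ) < (weight n fun k => d (k + 1)).2 := by exact_mod_cast w2
  have hx := h.x_pos 0 (by omega)
  have hy := h.y_pos 0 (by omega)
  have hxy := h.x_add_y 0 (by omega)
  cases hd : d 0 with
  | true =>
    obtain ⟨e1, e2, e3⟩ := h.step_true 0 (by omega) hd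
    rw [← hxy, slopeSum_succ_true hd, hxy, ← e1, ← e2, ← e3]
    have := mul_pos w1' hy
    simp only [zero_add]; linarith
  | false =>
    obtain ⟨e1, e2, e3⟩ := h.step_false 0 (by omega) hd
    rw [← hxy, slopeSum_succ_false hd, hxy, ← e1, ← e2, ← e3]
    have := mul_pos w2' hx
    simp only [zero_add]; linarith

/-- On the folded torus `C = π` and `A + B = 0`, so the sum `A + B + 2C` equals `2π`; going outward
it only grows. -/
theorem IsPleating.two_pi_le (h : IsPleating n d x y A B C) :
    2 * Real.pi ≤ slopeSum n d (A 0) (B 0) (C 0) := by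
  induction n generalizing d x y A B C with
  | zero =>
    have h1 := h.sum_eq
    have h2 := h.last
    simp only [slopeSum, weight, Nat.cast_one]
    linarith
  | succ n ih => exact (ih h.tail).trans h.slopeSum_tail_lt.le

theorem IsPleating.two_pi_lt (h : IsPleating (n + 1) d x y A B C) :
    2 * Real.pi < slopeSum (n + 1) d (A 0) (B 0) (C 0) :=
  h.tail.two_pi_le.trans_lt h.slopeSum_tail_lt

/-- Prepending a value to a sequence. -/
def cons (a : ℝ) (f : ℕ → ℝ) (k : ℕ) : ℝ := Nat.casesOn k a f

theorem IsPleating.cons {a b c s t : ℝ}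
    (h : IsPleating n (fun k => d (k + 1)) x y A B C) (hs : 0 < s) (ht : 0 < t) (hc : s + t < Real.pi)
    (hst : s + t = c) (habc : a + b + c = Real.pi)
    (htrue : d 0 = true → A 0 = -c ∧ B 0 = b + 2 * t ∧ C 0 = a + 2 * s)
    (hfalse : d 0 = false → A 0 = a + 2 * s ∧ B 0 = -c ∧ C 0 = b + 2 * t) :
    IsPleating (n + 1) d (cons s x) (LayeredSolidTorus.cons t y) (LayeredSolidTorus.cons a A)
      (LayeredSolidTorus.cons b B) (LayeredSolidTorus.cons c C) where
  x_pos
    | 0, _ => hs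
    | k + 1, hk => h.x_pos k (by omega)
  y_pos
    | 0, _ => ht
    | k + 1, hk => h.y_pos k (by omega)
  x_add_y
    | 0, _ => hst
    | k + 1, hk => h.x_add_y k (by omega)
  lt_pi
    | 0, _ => hst ▸ hc
    | k + 1, hk => h.lt_pi k (by omega)
  sum_eq := habc
  step_true
    | 0, _ => htrue
    | k + 1, hk => h.step_true k (by omega)
  step_false
    | 0, _ => hfalse
    | k + 1, hk => h.step_false k (by omega)
  last := h.last

/-- The choice of the angles of one tetrahedron that is not the last one: `P + Q`, `Q` and
`P + 2 * Q` are the intersection numbers of the meridian with the three outer slopes. -/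
theorem exists_angle {a b c P Q : ℝ} (hP : 1 ≤ P) (hQ : 1 ≤ Q) (hPQ : 2 < P + Q)
    (habc : a + b + c = Real.pi) (ha : a < Real.pi) (hb : b < Real.pi) (hc : 0 < c)
    (hc' : c < Real.pi)
    (hG : 2 * Real.pi < (P + Q) * a + Q * b + (P + Q + Q) * c) :
    ∃ s t, 0 < s ∧ 0 < t ∧ s + t = c ∧ 0 < a + 2 * s ∧ a + 2 * s < Real.pi ∧
      b + 2 * t < Real.pi ∧
      2 * Real.pi < P * (-c) + Q * (b + 2 * t) + (P + Q) * (a + 2 * s) := by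
  have hpi := Real.pi_pos
  -- With `t = c - s`, the upper bounds on `s` express `t > 0` and `a + 2s < π`. The lower bounds
  -- express `s > 0` and `b + 2t < π`; as `c > 0`, the latter also yields `a + 2s > 0`.
  set g : ℝ := min c ((Real.pi - a) / 2) with hg
  set l : ℝ := max 0 ((c - a) / 2) with hl
  -- The bound on `s` coming from the sum, which is increasing in `s` with slope `2 * P`.
  set l' : ℝ := (2 * Real.pi - (P * (-c) + Q * (b + 2 * c) + (P + Q) * a)) / (2 * P) with hl'
  have hP0 : 0 < 2 * P := by linarith
  have key : max l l' < g := by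
    rw [hg, hl, lt_min_iff, max_lt_iff, max_lt_iff, max_lt_iff, max_lt_iff, hl',
      div_lt_iff₀ hP0, div_lt_iff₀ hP0]
    -- At `s = c` nothing is lost, `t` being `0`, so the new sum is the one in `hG`.
    refine ⟨⟨⟨hc, by linarith⟩, by nlinarith⟩, ⟨⟨by linarith, by linarith⟩, ?_⟩⟩
    -- The value for `a + 2 * s = π` is a convex combination of `(P + Q) * π` and `2 * Q * π`.
    have h1 : 0 < (P + Q - 2) * (Real.pi - c) := mul_pos (by linarith) (by linarith)
    have h2 : 0 ≤ (Q - 1) * c := mul_nonneg (by linarith) hc.le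
    have hb' : b = Real.pi - a - c := by linarith
    rw [hb']
    nlinarith
  obtain ⟨s, hs1, hs2⟩ := exists_between key
  rw [max_lt_iff, hl, max_lt_iff] at hs1
  rw [hg, lt_min_iff] at hs2
  obtain ⟨⟨hs0, hsl⟩, hsl'⟩ := hs1
  rw [hl', div_lt_iff₀ hP0] at hsl'
  refine ⟨s, c - s, hs0, by linarith, by ring, by linarith, by linarith, by linarith, ?_⟩
  nlinarith

/-- Induction inward: the bounds on `a, b, c` and on the sum are exactly what `exists_angle`
restores on the next torus. -/
theorem exists_isPleating (n : ℕ) (d : ℕ → Bool) (a b c : ℝ) (habc : a + b + c = Real.pi)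
    (ha : a < Real.pi) (hb : b < Real.pi) (hc : 0 < c) (hc' : c < Real.pi)
    (hG : 2 * Real.pi < slopeSum (n + 1) d a b c) :
    ∃ x y A B C : ℕ → ℝ, IsPleating (n + 1) d x y A B C ∧ A 0 = a ∧ B 0 = b ∧ C 0 = c := by
  induction n generalizing d a b c with
  | zero =>
    cases hd : d 0 with
    | true =>
      simp only [slopeSum, weight, hd, if_true] at hG
      push_cast at hG
      -- The fold forces `a + 2s = π`; then `t > 0` is precisely the assumed inequality.
      have h0 : IsPleating 0 (fun k => d (k + 1)) (fun _ => 0) (fun _ => 0) (fun _ => -c)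
          (fun _ => b + 2 * (c - (Real.pi - a) / 2)) (fun _ => a + 2 * ((Real.pi - a) / 2)) :=
        ⟨by simp, by simp, by simp, by simp, by linarith, by simp, by simp, by ring⟩
      exact ⟨_, _, _, _, _, h0.cons (a := a) (b := b) (c := c) (s := (Real.pi - a) / 2)
        (t := c - (Real.pi - a) / 2) (by linarith) (by linarith) (by linarith) (by ring) habc
        (fun _ => ⟨rfl, rfl, rfl⟩) (fun h => by simp [hd] at h), rfl, rfl, rfl⟩
    | false =>
      simp only [slopeSum, weight, hd] at hG
      norm_num at hG
      have h0 : IsPleating 0 (fun k => d (k + 1)) (fun _ => 0) (fun _ => 0)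
          (fun _ => a + 2 * (c - (Real.pi - b) / 2)) (fun _ => -c)
          (fun _ => b + 2 * ((Real.pi - b) / 2)) :=
        ⟨by simp, by simp, by simp, by simp, by linarith, by simp, by simp, by ring⟩
      exact ⟨_, _, _, _, _, h0.cons (a := a) (b := b) (c := c) (t := (Real.pi - b) / 2)
        (s := c - (Real.pi - b) / 2) (by linarith) (by linarith) (by linarith) (by ring) habc
        (fun h => by simp [hd] at h) (fun _ => ⟨rfl, rfl, rfl⟩), rfl, rfl, rfl⟩
  | succ n ih =>
    obtain ⟨w1, w2⟩ := weight_pos (n + 1) fun k => d (k + 1)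
    have w1' : (1 : ℝ) ≤ (weight (n + 1) fun k => d (k + 1)).1 := by exact_mod_cast w1
    have w2' : (1 : ℝ) ≤ (weight (n + 1) fun k => d (k + 1)).2 := by exact_mod_cast w2
    have w3 : (2 : ℝ) < (weight (n + 1) fun k => d (k + 1)).1 +
        (weight (n + 1) fun k => d (k + 1)).2 := by exact_mod_cast two_lt_weight_add n _
    cases hd : d 0 with
    | true =>
      rw [slopeSum, weight] at hG
      simp only [hd, if_true] at hG
      push_cast at hG
      obtain ⟨s, t, hs, ht, hst, h1, h2, h3, h4⟩ :=
        exists_angle w1' w2' w3 habc ha hb hc hc' hG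
      obtain ⟨x, y, A, B, C, h, hA, hB, hC⟩ := ih (fun k => d (k + 1)) (-c) (b + 2 * t) (a + 2 * s)
        (by linarith) (by linarith) h3 h1 h2 h4
      exact ⟨_, _, _, _, _, h.cons hs ht (by linarith) hst habc (fun _ => ⟨hA, hB, hC⟩)
        (fun h => by simp [hd] at h), rfl, rfl, rfl⟩
    | false =>
      rw [slopeSum, weight] at hG
      simp only [hd] at hG
      simp at hG
      -- The mirror image of the other case, with the two sides interchanged.
      obtain ⟨t, s, ht, hs, hst, h1, h2, h3, h4⟩ :=
        exists_angle (a := b) (b := a) (c := c) w2' w1' (by linarith) (by linarith) hb ha hc hc'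
          (by linarith)
      obtain ⟨x, y, A, B, C, h, hA, hB, hC⟩ := ih (fun k => d (k + 1)) (a + 2 * s) (-c) (b + 2 * t)
        (by linarith) h3 (by linarith) h1 h2 (by rw [slopeSum]; linarith)
      exact ⟨_, _, _, _, _, h.cons hs ht (by linarith) (by linarith) habc
        (fun h => by simp [hd] at h) (fun _ => ⟨hA, hB, hC⟩), rfl, rfl, rfl⟩

end LayeredSolidTorus

/-! ### Edges of one tetrahedron, sorted by direction -/

namespace TetEdge

/-- The kind of an edge of a layered tetrahedron with vertices over `0, u, u + w, w`: a side `u`, a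
side `w`, the outer diagonal `u - w` or the inner diagonal `u + w`. -/
def kind (e : TetEdge) : Fin 4 :=
  if e.1 = {0, 1} ∨ e.1 = {2, 3} then 0
  else if e.1 = {0, 3} ∨ e.1 = {1, 2} then 1
  else if e.1 = {1, 3} then 2 else 3

/-- An edge of a given kind. -/
def ofKind : Fin 4 → TetEdge :=
  ![⟨{0, 1}, rfl⟩, ⟨{0, 3}, rfl⟩, ⟨{1, 3}, rfl⟩, ⟨{0, 2}, rfl⟩]

theorem kind_ofKind : ∀ c, (ofKind c).kind = c := by decide

theorem eq_ofKind_or : ∀ e : TetEdge, e = ofKind e.kind ∨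
    (e.kind = 0 ∧ e = ⟨{2, 3}, rfl⟩) ∨ (e.kind = 1 ∧ e = ⟨{1, 2}, rfl⟩) := by decide

theorem kind_opp : ∀ e : TetEdge, (e.opp.kind = e.kind ∧ e.kind < 2) ∨
    (e.opp.kind = 3 ∧ e.kind = 2) ∨ (e.opp.kind = 2 ∧ e.kind = 3) := by decide

theorem univ_eq : (Finset.univ : Finset TetEdge) =
    {⟨{0, 1}, rfl⟩, ⟨{2, 3}, rfl⟩, ⟨{0, 3}, rfl⟩, ⟨{1, 2}, rfl⟩, ⟨{1, 3}, rfl⟩, ⟨{0, 2}, rfl⟩} := by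
  decide

theorem sum_kind (g : Fin 4 → ℝ) :
    ∑ e : TetEdge, g e.kind = 2 * g 0 + 2 * g 1 + g 2 + g 3 := by
  rw [univ_eq, Finset.sum_insert (by decide), Finset.sum_insert (by decide),
    Finset.sum_insert (by decide), Finset.sum_insert (by decide), Finset.sum_insert (by decide),
    Finset.sum_singleton]
  change g 0 + (g 0 + (g 1 + (g 1 + (g 2 + g 3)))) = _
  ring

theorem filter_mem_eq : ∀ v : Fin 4, ∃ a b c : TetEdge, a ≠ b ∧ a ≠ c ∧ b ≠ c ∧
    Finset.univ.filter (fun e : TetEdge => v ∈ e.1) = {a, b, c} ∧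
    a.kind = 0 ∧ b.kind = 1 ∧ (c.kind = 2 ∨ c.kind = 3) := by decide

end TetEdge

/-! ### Classification of the edges of the triangulation -/

namespace LayeredSolidTorus

open TetEdge

variable {n : ℕ} {d : ℕ → Bool}

/-- Labels of the three outer slopes `u`, `w`, `u - w` of the `k`-th tetrahedron; the slope that is
new in the `k`-th exchange has the label `k + 3`. -/
def outerLabel (d : ℕ → Bool) : ℕ → ℕ × ℕ × ℕ
  | 0 => (0, 1, 2)
  | k + 1 => if d k then (k + 3, (outerLabel d k).2.1, (outerLabel d k).1)
    else ((outerLabel d k).1, k + 3, (outerLabel d k).2.1)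

/-- Labels of the edges of the `k`-th of `n` tetrahedra by their kind.  The last new slope is
identified with one of the sides by the folding. -/
def label (n : ℕ) (d : ℕ → Bool) (k : ℕ) : Fin 4 → ℕ :=
  ![(outerLabel d k).1, (outerLabel d k).2.1, (outerLabel d k).2.2,
    if k + 1 < n then k + 3 else if d k then (outerLabel d k).2.1 else (outerLabel d k).1]

/-- The kind in a tetrahedron of an outer edge of the next tetrahedron. -/
def prevKind (d : Bool) : Fin 4 → Fin 4 :=
  if d then ![3, 1, 0, 3] else ![0, 3, 1, 3]

/-- The identification of kinds in the last tetrahedron by the folding. -/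
def foldKind (d : Bool) : Fin 4 → Fin 4 :=
  if d then ![0, 1, 2, 1] else ![0, 1, 2, 0]

/-- The kind `3` is excluded because the inner diagonal of a tetrahedron is not an edge of the
previous one; the entry of `prevKind` there is a placeholder. -/
theorem label_succ {k : ℕ} (hk : k + 1 < n) {c : Fin 4} (hc : c ≠ 3) :
    label n d (k + 1) c = label n d k (prevKind (d k) c) := by
  cases hd : d k <;> fin_cases c <;> simp [label, outerLabel, prevKind, hd, hk] at hc ⊢

theorem label_foldKind {k : ℕ} (hk : ¬ k + 1 < n) (c : Fin 4) :
    label n d k (foldKind (d k) c) = label n d k c := by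
  cases hd : d k <;> fin_cases c <;> simp [label, foldKind, hd, hk]

theorem kind_layer_inner : ∀ (d : Bool) (f : Fin 4) (e : TetEdge), ¬ (f = 0 ∨ f = 2) → f ∉ e.1 →
    prevKind d (e.map (layer d f)).kind = e.kind ∧ (e.map (layer d f)).kind ≠ 3 := by
  decide

theorem kind_layer_outer : ∀ (d : Bool) (f : Fin 4) (e : TetEdge), f = 0 ∨ f = 2 → f ∉ e.1 →
    (e.map (layer d f)).kind = prevKind d e.kind ∧ e.kind ≠ 3 := by
  decide

theorem kind_fold : ∀ (d : Bool) (f : Fin 4) (e : TetEdge), ¬ (f = 0 ∨ f = 2) → f ∉ e.1 →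
    foldKind d (e.map (if f = 3 then fold d else (fold d)⁻¹)).kind = foldKind d e.kind := by
  decide

/-- The label of an edge of a tetrahedron. -/
def edgeLabel (n : ℕ) (d : ℕ → Bool) (a : Fin n × TetEdge) : ℕ := label n d a.1 a.2.kind

/-- Labels are an invariant of edge classes: a layering acts on kinds through `prevKind`, the fold
through `foldKind`, and labels respect both. -/
theorem edgeLabel_eq_of_edgeStep {a b : Fin n × TetEdge}
    (h : (triangulation n d).EdgeStep a b) : edgeLabel n d a = edgeLabel n d b := by
  obtain ⟨⟨t, ht⟩, e⟩ := a
  obtain ⟨t', e'⟩ := b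
  obtain ⟨f, σ, hf, hg, he⟩ := h
  simp only at hf hg he
  subst he
  change glue n d ⟨t, ht⟩ f = _ at hg
  by_cases hf2 : f = 0 ∨ f = 2
  · by_cases h0 : 0 < t
    · simp only [glue, hf2, h0, if_true, Option.some.injEq, Prod.mk.injEq] at hg
      obtain ⟨rfl, rfl⟩ := hg
      obtain ⟨k, rfl⟩ : ∃ k, t = k + 1 := ⟨t - 1, by omega⟩
      obtain ⟨h1, h2⟩ := kind_layer_outer (d k) f e hf2 hf
      simp only [edgeLabel, Nat.add_sub_cancel, h1, label_succ ht h2]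
    · simp [glue, hf2, h0] at hg
  · by_cases hn : t + 1 < n
    · simp only [glue, hf2, hn, if_false, dif_pos, Option.some.injEq, Prod.mk.injEq] at hg
      obtain ⟨rfl, rfl⟩ := hg
      obtain ⟨h1, h2⟩ := kind_layer_inner (d t) f e hf2 hf
      simp only [edgeLabel, label_succ hn h2, h1]
    · simp only [glue, hf2, hn, if_false, dite_false, Option.some.injEq, Prod.mk.injEq] at hg
      obtain ⟨rfl, rfl⟩ := hg
      simp only [edgeLabel]
      rw [← label_foldKind hn e.kind, ← kind_fold (d t) f e hf2 hf, label_foldKind hn]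

theorem edge_eq_layer {t : ℕ} (ht : t + 1 < n) {f : Fin 4} (hf2 : ¬ (f = 0 ∨ f = 2)) {e : TetEdge}
    (hf : f ∉ e.1) : (triangulation n d).edge ⟨t, by omega⟩ e =
    (triangulation n d).edge ⟨t + 1, ht⟩ (e.map (layer (d t) f)) :=
  Quot.sound ⟨f, layer (d t) f, hf, by simp [triangulation, glue, hf2, ht], rfl⟩

theorem edge_eq_fold {t : ℕ} (ht : t < n) (ht' : ¬ t + 1 < n) {f : Fin 4}
    (hf2 : ¬ (f = 0 ∨ f = 2)) {e : TetEdge} (hf : f ∉ e.1) :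
    (triangulation n d).edge ⟨t, ht⟩ e =
    (triangulation n d).edge ⟨t, ht⟩ (e.map (if f = 3 then fold (d t) else (fold (d t))⁻¹)) :=
  Quot.sound ⟨f, _, hf, by simp [triangulation, glue, hf2, ht'], rfl⟩

/-- Parallel sides are identified only thanks to the fold, so the induction runs outward from the
last tetrahedron. There, one pair of sides is glued directly and the other through the inner
diagonal. Further out, the two copies of the side dropped next are glued to a single covered
diagonal, and those of the other side to parallel sides of the next tetrahedron. -/
theorem edge_parallel (j : ℕ) : ∀ t (ht : t + j + 1 = n),
    (triangulation n d).edge ⟨t, by omega⟩ ⟨{0, 1}, rfl⟩ =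
      (triangulation n d).edge ⟨t, by omega⟩ ⟨{2, 3}, rfl⟩ ∧
    (triangulation n d).edge ⟨t, by omega⟩ ⟨{0, 3}, rfl⟩ =
      (triangulation n d).edge ⟨t, by omega⟩ ⟨{1, 2}, rfl⟩ := by
  induction j with
  | zero =>
    intro t ht
    have h1 := edge_eq_fold (d := d) (n := n) (t := t) (by omega) (by omega) (f := 3) (by decide)
      (e := ⟨{0, 1}, rfl⟩) (by decide)
    have h2 := edge_eq_fold (d := d) (n := n) (t := t) (by omega) (by omega) (f := 1) (by decide)
      (e := ⟨{2, 3}, rfl⟩) (by decide)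
    have h3 := edge_eq_fold (d := d) (n := n) (t := t) (by omega) (by omega) (f := 1) (by decide)
      (e := ⟨{0, 3}, rfl⟩) (by decide)
    have h4 := edge_eq_fold (d := d) (n := n) (t := t) (by omega) (by omega) (f := 3) (by decide)
      (e := ⟨{1, 2}, rfl⟩) (by decide)
    cases hd : d t <;> rw [hd] at h1 h2 h3 h4
    · exact ⟨h1.trans ((congrArg _ (by decide)).trans h2.symm),
        (h4.trans (congrArg _ (by decide))).symm⟩
    · exact ⟨h1.trans (congrArg _ (by decide)), h3.trans ((congrArg _ (by decide)).trans h4.symm)⟩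
  | succ j ih =>
    intro t ht
    obtain ⟨i1, i2⟩ := ih (t + 1) (by omega)
    have h1 := edge_eq_layer (d := d) (n := n) (t := t) (by omega) (f := 3) (by decide)
      (e := ⟨{0, 1}, rfl⟩) (by decide)
    have h2 := edge_eq_layer (d := d) (n := n) (t := t) (by omega) (f := 1) (by decide)
      (e := ⟨{2, 3}, rfl⟩) (by decide)
    have h3 := edge_eq_layer (d := d) (n := n) (t := t) (by omega) (f := 1) (by decide)
      (e := ⟨{0, 3}, rfl⟩) (by decide)
    have h4 := edge_eq_layer (d := d) (n := n) (t := t) (by omega) (f := 3) (by decide)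
      (e := ⟨{1, 2}, rfl⟩) (by decide)
    cases hd : d t <;> rw [hd] at h1 h2 h3 h4
    · exact ⟨h1.trans ((congrArg _ (by decide)).trans
          (i1.trans ((congrArg _ (by decide)).trans h2.symm))),
        h3.trans ((congrArg _ (by decide)).trans h4.symm)⟩
    · exact ⟨h1.trans ((congrArg _ (by decide)).trans h2.symm),
        h3.trans ((congrArg _ (by decide)).trans
          (i2.trans ((congrArg _ (by decide)).trans h4.symm)))⟩

theorem edge_eq_ofKind (t : Fin n) (e : TetEdge) :
    (triangulation n d).edge t e = (triangulation n d).edge t (ofKind e.kind) := by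
  obtain ⟨h1, h2⟩ := edge_parallel (d := d) (n := n) (n - 1 - t) t (by omega)
  rcases eq_ofKind_or e with h | ⟨h, h'⟩ | ⟨h, h'⟩
  · rw [← h]
  · rw [h, h']; exact h1.symm
  · rw [h, h']; exact h2.symm

theorem edge_succ {t : ℕ} (ht : t + 1 < n) {c : Fin 4} (hc : c ≠ 3) :
    (triangulation n d).edge ⟨t + 1, ht⟩ (ofKind c) =
    (triangulation n d).edge ⟨t, by omega⟩ (ofKind (prevKind (d t) c)) := by
  have key : ∀ (b : Bool) (c : Fin 4), c ≠ 3 → ∃ f : Fin 4, ¬ (f = 0 ∨ f = 2) ∧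
      f ∉ (ofKind (prevKind b c)).1 ∧ (ofKind (prevKind b c)).map (layer b f) = ofKind c := by
    decide
  obtain ⟨f, h1, h2, h3⟩ := key (d t) c hc
  rw [edge_eq_layer ht h1 h2, h3]

theorem edge_foldKind {t : ℕ} (ht : t < n) (ht' : ¬ t + 1 < n) (c : Fin 4) :
    (triangulation n d).edge ⟨t, ht⟩ (ofKind c) =
    (triangulation n d).edge ⟨t, ht⟩ (ofKind (foldKind (d t) c)) := by
  have key : ∀ (b : Bool) (c : Fin 4), c = foldKind b c ∨ ∃ f : Fin 4, ¬ (f = 0 ∨ f = 2) ∧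
      f ∉ (ofKind (foldKind b c)).1 ∧
      (ofKind (foldKind b c)).map (if f = 3 then fold b else (fold b)⁻¹) = ofKind c := by
    decide
  rcases key (d t) c with h | ⟨f, h1, h2, h3⟩
  · rw [← h]
  · rw [edge_eq_fold ht ht' h1 h2, h3]

/-- An edge with a given label. -/
def edgeOfLabel (hn : 0 < n) (d : ℕ → Bool) (j : ℕ) : (triangulation n d).Edge :=
  if h : j < 3 then (triangulation n d).edge ⟨0, hn⟩ (ofKind ⟨j, by omega⟩)
  else if h' : j - 3 < n then (triangulation n d).edge ⟨j - 3, h'⟩ (ofKind 3)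
  else (triangulation n d).edge ⟨0, hn⟩ (ofKind 0)

/-- Outer edges are traced back to the previous tetrahedron, down to the boundary. An inner diagonal
represents its own label, except in the last tetrahedron, where the fold moves it to a side. -/
theorem edge_ofKind_eq_edgeOfLabel (hn : 0 < n) (k : ℕ) : ∀ (hk : k < n) (c : Fin 4),
    (triangulation n d).edge ⟨k, hk⟩ (ofKind c) = edgeOfLabel hn d (label n d k c) := by
  suffices H : ∀ k (hk : k < n) (c : Fin 4), (c ≠ 3 →
      (triangulation n d).edge ⟨k, hk⟩ (ofKind c) = edgeOfLabel hn d (label n d k c)) →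
      (triangulation n d).edge ⟨k, hk⟩ (ofKind (foldKind (d k) c)) =
        edgeOfLabel hn d (label n d k (foldKind (d k) c)) →
      (triangulation n d).edge ⟨k, hk⟩ (ofKind c) = edgeOfLabel hn d (label n d k c) by
    have hfold : ∀ (b : Bool) (c : Fin 4), foldKind b c ≠ 3 := by decide
    induction k with
    | zero =>
      intro hk c
      have h0 : ∀ c : Fin 4, c ≠ 3 →
          (triangulation n d).edge ⟨0, hk⟩ (ofKind c) = edgeOfLabel hn d (label n d 0 c) := by
        intro c hc
        fin_cases c <;> first | rfl | exact absurd rfl hc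
      exact H 0 hk c (h0 c) (h0 _ (hfold _ _))
    | succ k ih =>
      intro hk c
      have h0 : ∀ c : Fin 4, c ≠ 3 → (triangulation n d).edge ⟨k + 1, hk⟩ (ofKind c) =
          edgeOfLabel hn d (label n d (k + 1) c) := by
        intro c hc
        rw [edge_succ hk hc, label_succ hk hc, ih]
      exact H (k + 1) hk c (h0 c) (h0 _ (hfold _ _))
  intro k hk c h1 h2
  by_cases hc : c = 3
  · subst hc
    by_cases hk' : k + 1 < n
    · have hl : label n d k 3 = k + 3 := by simp [label, hk']
      rw [hl]
      simp [edgeOfLabel, hk]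
    · rw [edge_foldKind hk hk', h2, label_foldKind hk']
  · exact h1 hc

theorem edge_eq_edgeOfLabel (hn : 0 < n) (t : Fin n) (e : TetEdge) :
    (triangulation n d).edge t e = edgeOfLabel hn d (label n d t e.kind) := by
  rw [edge_eq_ofKind]
  exact edge_ofKind_eq_edgeOfLabel hn t t.2 e.kind

/-- The edges of the triangulation are classified by their labels. -/
theorem edge_eq_iff (t t' : Fin n) (e e' : TetEdge) :
    (triangulation n d).edge t e = (triangulation n d).edge t' e' ↔
    label n d t e.kind = label n d t' e'.kind := by
  constructor
  · intro h
    exact congrArg (Quot.lift (edgeLabel n d) fun _ _ => edgeLabel_eq_of_edgeStep) h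
  · intro h
    rw [edge_eq_edgeOfLabel t.pos, edge_eq_edgeOfLabel t.pos t', h]

theorem outerLabel_spec (d : ℕ → Bool) (k : ℕ) :
    (outerLabel d k).1 < k + 3 ∧ (outerLabel d k).2.1 < k + 3 ∧ (outerLabel d k).2.2 < k + 3 ∧
    (outerLabel d k).1 ≠ (outerLabel d k).2.1 ∧ (outerLabel d k).1 ≠ (outerLabel d k).2.2 ∧
    (outerLabel d k).2.1 ≠ (outerLabel d k).2.2 := by
  induction k with
  | zero => simp [outerLabel]
  | succ k ih =>
    rw [outerLabel]
    split_ifs <;> simp only <;> omega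

theorem label_lt_or {k : ℕ} (hk : k < n) (c : Fin 4) :
    label n d k c < 3 ∨ ∃ i, i + 1 < n ∧ label n d k c = i + 3 := by
  have h := outerLabel_spec d k
  have : label n d k c < 3 ∨ label n d k c - 3 + 1 < n := by
    fin_cases c <;> simp [label] <;> try split_ifs
    all_goals omega
  rcases this with h | h
  · exact Or.inl h
  · by_cases h3 : label n d k c < 3
    · exact Or.inl h3
    · exact Or.inr ⟨label n d k c - 3, h, by omega⟩

theorem glue_eq_none_iff (t : Fin n) (f : Fin 4) :
    (triangulation n d).glue t f = none ↔ t.1 = 0 ∧ (f = 0 ∨ f = 2) := by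
  change glue n d t f = none ↔ _
  unfold glue
  split_ifs with h1 h2 h2
  · simp [h2.ne']
  · simp [h1, Nat.eq_zero_of_not_pos h2]
  · simp [h1]
  · simp [h1]

theorem isBoundaryEdge_iff (t : Fin n) (e : TetEdge) :
    (triangulation n d).IsBoundaryEdge ((triangulation n d).edge t e) ↔
    label n d t e.kind < 3 := by
  have key1 : ∀ (f : Fin 4) (e : TetEdge), f = 0 ∨ f = 2 → f ∉ e.1 → e.kind ≠ 3 := by decide
  have key2 : ∀ c : Fin 4, c ≠ 3 → ∃ f : Fin 4, (f = 0 ∨ f = 2) ∧ f ∉ (ofKind c).1 := by decide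
  have key3 : ∀ c : Fin 4, c ≠ 3 → label n d 0 c = c := by
    intro c hc
    fin_cases c <;> first | rfl | exact absurd rfl hc
  constructor
  · rintro ⟨t', e', f, he, hf, hg⟩
    rw [edge_eq_iff] at he
    obtain ⟨h0, hf2⟩ := (glue_eq_none_iff t' f).1 hg
    have hk := key1 f e' hf2 hf
    rw [← he, h0, key3 _ hk]
    omega
  · intro h
    generalize hj : label n d t e.kind = j at h
    obtain ⟨c, hc⟩ : ∃ c : Fin 4, c.1 = j := ⟨⟨j, by omega⟩, rfl⟩
    have hc3 : c ≠ 3 := by rintro rfl; simp at hc; omega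
    obtain ⟨f, hf2, hf⟩ := key2 c hc3
    exact ⟨⟨0, t.pos⟩, ofKind c, f, by rw [edge_eq_iff, kind_ofKind, key3 c hc3, hc, hj], hf,
      (glue_eq_none_iff _ f).2 ⟨rfl, hf2⟩⟩

/-- The sum of the angles of the `k`-th tetrahedron at its edges with the label `j`. -/
def labelAngle (n : ℕ) (d : ℕ → Bool) (x y z : ℕ → ℝ) (k j : ℕ) : ℝ :=
  (if label n d k 0 = j then 2 * x k else 0) + (if label n d k 1 = j then 2 * y k else 0) +
  (if label n d k 2 = j then z k else 0) + (if label n d k 3 = j then z k else 0)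

/-- Each side direction occurs on two parallel edges of a tetrahedron and each diagonal on one,
whence the factors in `labelAngle`. -/
theorem angleSum_eq {α : Fin n → TetEdge → ℝ} {x y z : ℕ → ℝ}
    (hα : ∀ (t : Fin n) e, α t e = ![x t, y t, z t, z t] e.kind) (t : Fin n) (e : TetEdge) :
    (triangulation n d).angleSum α ((triangulation n d).edge t e) =
    ∑ k ∈ Finset.Ico 0 n, labelAngle n d x y z k (label n d t e.kind) := by
  rw [← Finset.range_eq_Ico, ← Fin.sum_univ_eq_sum_range]
  unfold IdealTriangulation.angleSum
  refine Finset.sum_congr rfl fun t' _ => ?_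
  simp only [edge_eq_iff, hα]
  have := sum_kind fun c => if label n d t' c = label n d t e.kind then
    (![x t', y t', z t', z t'] : Fin 4 → ℝ) c else 0
  refine (Finset.sum_congr rfl fun e' _ => ?_).trans (this.trans ?_)
  · congr
  · simp [labelAngle, mul_ite]

end LayeredSolidTorus

/-! ### Angle sums around edges versus exterior angles -/

namespace LayeredSolidTorus

open TetEdge Slope

variable {n : ℕ} {d : ℕ → Bool} {x y z : ℕ → ℝ}

/-- The sum of the angles at the edges with the label `j` of all tetrahedra from the `k`-th on. -/
def labelSum (n : ℕ) (d : ℕ → Bool) (x y z : ℕ → ℝ) (k j : ℕ) : ℝ :=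
  ∑ i ∈ Finset.Ico k n, labelAngle n d x y z i j

theorem labelSum_eq_add {k : ℕ} (hk : k < n) (j : ℕ) : labelSum n d x y z k j =
    labelAngle n d x y z k j + labelSum n d x y z (k + 1) j :=
  Finset.sum_eq_sum_Ico_succ_bot hk _

/-- A slope that has disappeared never returns: later outer labels are either survivors or new. -/
theorem labelSum_eq_zero {k j : ℕ} (hj : j < k + 3) (h1 : j ≠ (outerLabel d k).1)
    (h2 : j ≠ (outerLabel d k).2.1) (h3 : j ≠ (outerLabel d k).2.2) :
    labelSum n d x y z k j = 0 := by
  have H : ∀ i, j < k + i + 3 ∧ j ≠ (outerLabel d (k + i)).1 ∧ j ≠ (outerLabel d (k + i)).2.1 ∧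
      j ≠ (outerLabel d (k + i)).2.2 := by
    intro i
    induction i with
    | zero => exact ⟨hj, h1, h2, h3⟩
    | succ i ih =>
      rw [← add_assoc, outerLabel]
      split_ifs <;> simp only <;> omega
  refine Finset.sum_eq_zero fun i hi => ?_
  rw [Finset.mem_Ico] at hi
  obtain ⟨i, rfl⟩ := Nat.exists_eq_add_of_le hi.1
  obtain ⟨e1, e2, e3, e4⟩ := H i
  have e5 : label n d (k + i) 3 ≠ j := by
    simp only [label, Matrix.cons_val]
    split_ifs <;> omega
  simp [labelAngle, e5]
  simp [label, e2.symm, e3.symm, e4.symm]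

theorem labelSum_new {k : ℕ} (hk : k + 1 < n) : labelSum n d x y z 0 (k + 3) =
    z k + labelSum n d x y z (k + 1) (k + 3) := by
  have h1 : labelSum n d x y z 0 (k + 3) = labelSum n d x y z k (k + 3) := by
    unfold labelSum
    rw [← Finset.sum_Ico_consecutive _ (Nat.zero_le k) (by omega : k ≤ n), add_eq_right]
    refine Finset.sum_eq_zero fun i hi => ?_
    rw [Finset.mem_Ico] at hi
    obtain ⟨e1, e2, e3, -⟩ := outerLabel_spec d i
    have hi' : i + 1 < n := by omega
    simp only [labelAngle, label, Matrix.cons_val, hi', if_true]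
    rw [if_neg (by omega), if_neg (by omega), if_neg (by omega), if_neg (by omega)]
    simp
  obtain ⟨e1, e2, e3, -⟩ := outerLabel_spec d k
  rw [h1, labelSum_eq_add (by omega)]
  simp only [labelAngle, label, Matrix.cons_val, hk, if_true]
  rw [if_neg (by omega), if_neg (by omega), if_neg (by omega)]
  simp

theorem labelSum_outer {k : ℕ} (hk : k + 1 < n) :
    labelSum n d x y z k (outerLabel d k).1 =
      2 * x k + labelSum n d x y z (k + 1) (outerLabel d k).1 ∧
    labelSum n d x y z k (outerLabel d k).2.1 =
      2 * y k + labelSum n d x y z (k + 1) (outerLabel d k).2.1 ∧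
    labelSum n d x y z k (outerLabel d k).2.2 = z k := by
  obtain ⟨e1, e2, e3, e4, e5, e6⟩ := outerLabel_spec d k
  have h0 : labelSum n d x y z (k + 1) (outerLabel d k).2.2 = 0 := by
    apply labelSum_eq_zero
    · omega
    all_goals rw [outerLabel]; split_ifs <;> simp only <;> omega
  rw [labelSum_eq_add (by omega), labelSum_eq_add (by omega) (outerLabel d k).2.1,
    labelSum_eq_add (by omega) (outerLabel d k).2.2, h0]
  simp only [labelAngle, label, Matrix.cons_val, hk, if_true]
  simp only [e4, e5, e6, e4.symm, e5.symm, e6.symm, e1.ne', e2.ne', e3.ne', if_false,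
    add_zero, zero_add, and_true]

/-- Folding across `u` identifies `u + w` with `w`, so the angle of the inner diagonal is added at
`w`; folding across `w` adds it at `u`. -/
theorem labelSum_outer_last {k : ℕ} (hk : k + 1 = n) :
    labelSum n d x y z k (outerLabel d k).1 = 2 * x k + (if d k then 0 else z k) ∧
    labelSum n d x y z k (outerLabel d k).2.1 = 2 * y k + (if d k then z k else 0) ∧
    labelSum n d x y z k (outerLabel d k).2.2 = z k := by
  obtain ⟨e1, e2, e3, e4, e5, e6⟩ := outerLabel_spec d k
  have h0 : ∀ j, labelSum n d x y z (k + 1) j = 0 := by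
    intro j
    simp [labelSum, hk]
  have hk' : ¬ k + 1 < n := by omega
  rw [labelSum_eq_add (by omega), labelSum_eq_add (by omega) (outerLabel d k).2.1,
    labelSum_eq_add (by omega) (outerLabel d k).2.2, h0, h0, h0]
  simp only [labelAngle, label, Matrix.cons_val, hk', if_false]
  cases d k <;> simp [e4, e5, e6, e4.symm, e5.symm, e6.symm]

/-- The angle sums around the edges of the layered solid torus are those of an angle structure with
the exterior angles `a, b, c` at the boundary. -/
structure IsBalanced (n : ℕ) (d : ℕ → Bool) (x y z : ℕ → ℝ) (a b c : ℝ) : Prop where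
  eq_zero : labelSum n d x y z 0 0 = Real.pi - a
  eq_one : labelSum n d x y z 0 1 = Real.pi - b
  eq_two : labelSum n d x y z 0 2 = Real.pi - c
  eq_interior : ∀ k, k + 1 < n → labelSum n d x y z 0 (k + 3) = 2 * Real.pi

/-- The exterior angles of the successive tori. -/
def exteriorAngle (d : ℕ → Bool) (x y : ℕ → ℝ) (a b c : ℝ) : ℕ → ℝ × ℝ × ℝ
  | 0 => (a, b, c)
  | k + 1 =>
    let s := exteriorAngle d x y a b c k
    if d k then (-s.2.2, s.2.1 + 2 * y k, s.1 + 2 * x k)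
    else (s.1 + 2 * x k, -s.2.2, s.2.1 + 2 * y k)

/-- What remains around an edge after peeling off `k` tetrahedra is the interior angle of the `k`-th
torus. At a new edge `2π - z = π + C` remains, that is, the exterior angle `-C`. -/
theorem IsBalanced.labelSum_outer_eq {a b c : ℝ} (h : IsBalanced n d x y z a b c) (k : ℕ) (hk : k < n) :
    labelSum n d x y z k (outerLabel d k).1 = Real.pi - (exteriorAngle d x y a b c k).1 ∧
    labelSum n d x y z k (outerLabel d k).2.1 = Real.pi - (exteriorAngle d x y a b c k).2.1 ∧
    labelSum n d x y z k (outerLabel d k).2.2 = Real.pi - (exteriorAngle d x y a b c k).2.2 := by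
  induction k with
  | zero => exact ⟨h.eq_zero, h.eq_one, h.eq_two⟩
  | succ k ih =>
    obtain ⟨i1, i2, i3⟩ := ih (by omega)
    obtain ⟨o1, o2, o3⟩ := labelSum_outer (x := x) (y := y) (z := z) (d := d) hk
    have hn := labelSum_new (x := x) (y := y) (z := z) (d := d) hk
    rw [h.eq_interior k hk] at hn
    rw [outerLabel, exteriorAngle]
    split_ifs <;> simp only <;> refine ⟨?_, ?_, ?_⟩ <;> linarith

theorem IsBalanced.isPleating {a b c : ℝ} (h : IsBalanced n d x y z a b c) (hn : 0 < n)
    (hx : ∀ k < n, 0 < x k) (hy : ∀ k < n, 0 < y k) (hz : ∀ k < n, 0 < z k)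
    (hxyz : ∀ k < n, x k + y k + z k = Real.pi) (habc : a + b + c = Real.pi) :
    IsPleating n d x y (fun k => (exteriorAngle d x y a b c k).1)
      (fun k => (exteriorAngle d x y a b c k).2.1) (fun k => (exteriorAngle d x y a b c k).2.2) := by
  have hzC : ∀ k < n, z k = Real.pi - (exteriorAngle d x y a b c k).2.2 := by
    intro k hk
    rw [← (h.labelSum_outer_eq k hk).2.2]
    rcases Nat.lt_or_ge (k + 1) n with h' | h'
    · exact (labelSum_outer h').2.2.symm
    · exact (labelSum_outer_last (by omega)).2.2.symm
  refine ⟨hx, hy, ?_, ?_, habc, ?_, ?_, ?_⟩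
  · intro k hk
    have := hxyz k hk
    have := hzC k hk
    linarith
  · intro k hk
    have := hz k hk
    have := hzC k hk
    linarith
  · intro k hk hd
    simp [exteriorAngle, hd]
  · intro k hk hd
    simp [exteriorAngle, hd]
  -- Only the last tetrahedron's two edges along the folded side remain around it; hence `A + 2x =
  -- π` or `B + 2y = π`.
  · obtain ⟨k, rfl⟩ : ∃ k, n = k + 1 := ⟨n - 1, by omega⟩
    obtain ⟨i1, i2, i3⟩ := h.labelSum_outer_eq k (by omega)
    obtain ⟨l1, l2, -⟩ := labelSum_outer_last (n := k + 1) (x := x) (y := y) (z := z) (d := d) rfl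
    simp only [exteriorAngle]
    cases hd : d k <;> simp only [hd, if_true, Bool.false_eq_true, if_false] at l1 l2 ⊢ <;> linarith

/-- The converse runs outward from the fold: `last` gives the sum at the folded side, and the total
`π` gives the sum at the other side. -/
theorem IsPleating.labelSum_outer_eq {A B C : ℕ → ℝ} (h : IsPleating n d x y A B C) (j : ℕ) :
    ∀ k, k + j + 1 = n →
    labelSum n d x y (fun k => Real.pi - C k) k (outerLabel d k).1 = Real.pi - A k ∧
    labelSum n d x y (fun k => Real.pi - C k) k (outerLabel d k).2.1 = Real.pi - B k ∧
    labelSum n d x y (fun k => Real.pi - C k) k (outerLabel d k).2.2 = Real.pi - C k := by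
  induction j with
  | zero =>
    intro k hk
    obtain ⟨l1, l2, l3⟩ := labelSum_outer_last (n := n) (x := x) (y := y)
      (z := fun k => Real.pi - C k) (d := d) hk
    rw [l1, l2, l3]
    have hs := h.sum_eq_pi (k := k) (by omega)
    have hxy := h.x_add_y k (by omega)
    have hl := h.last
    rw [← hk] at hl
    cases hd : d k with
    | true =>
      obtain ⟨-, -, e⟩ := h.step_true k (by omega) hd
      simp only [if_true]
      exact ⟨by linarith, by linarith, trivial⟩
    | false =>
      obtain ⟨-, -, e⟩ := h.step_false k (by omega) hd
      simp only [Bool.false_eq_true, if_false]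
      exact ⟨by linarith, by linarith, trivial⟩
  | succ j ih =>
    intro k hk
    obtain ⟨i1, i2, i3⟩ := ih (k + 1) (by omega)
    obtain ⟨o1, o2, o3⟩ := labelSum_outer (n := n) (k := k) (x := x) (y := y)
      (z := fun k => Real.pi - C k) (d := d) (by omega)
    rw [o1, o2, o3]
    rw [outerLabel] at i1 i2 i3
    cases hd : d k with
    | true =>
      obtain ⟨e1, e2, e3⟩ := h.step_true k (by omega) hd
      simp only [hd, if_true] at i1 i2 i3
      refine ⟨?_, ?_, ?_⟩ <;> linarith
    | false =>
      obtain ⟨e1, e2, e3⟩ := h.step_false k (by omega) hd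
      simp only [hd, Bool.false_eq_true, if_false] at i1 i2 i3
      refine ⟨?_, ?_, ?_⟩ <;> linarith

theorem IsPleating.isBalanced {A B C : ℕ → ℝ} (h : IsPleating n d x y A B C) (hn : 0 < n) :
    IsBalanced n d x y (fun k => Real.pi - C k) (A 0) (B 0) (C 0) := by
  obtain ⟨h1, h2, h3⟩ := h.labelSum_outer_eq (n - 1) 0 (by omega)
  refine ⟨h1, h2, h3, fun k hk => ?_⟩
  -- The slope `k + 3` is a side of tetrahedron `k + 1`, with exterior angle `-C k`; the total
  -- around it is `(π - C k) + (π + C k)`.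
  obtain ⟨i1, i2, -⟩ := h.labelSum_outer_eq (n - (k + 2)) (k + 1) (by omega)
  rw [labelSum_new hk]
  rw [outerLabel] at i1 i2
  cases hd : d k with
  | true =>
    obtain ⟨e1, -, -⟩ := h.step_true k (by omega) hd
    simp only [hd, if_true] at i1
    linarith
  | false =>
    obtain ⟨-, e2, -⟩ := h.step_false k (by omega) hd
    simp only [hd, Bool.false_eq_true, if_false] at i2
    linarith

/-! ### Angle structures and pleatings -/

theorem vertex_sum_eq (g : Fin 4 → ℝ) (hg : g 2 = g 3) (v : Fin 4) :
    ∑ e : TetEdge with v ∈ e.1, g e.kind = g 0 + g 1 + g 2 := by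
  obtain ⟨a, b, c, hab, hac, hbc, h, ha, hb, hc⟩ := filter_mem_eq v
  rw [h, Finset.sum_insert (by simp [hab, hac]), Finset.sum_insert (by simp [hbc]),
    Finset.sum_singleton, ha, hb]
  rcases hc with hc | hc <;> rw [hc]
  · ring
  · rw [hg]; ring

/-- Angles with equal opposite angles depend on the kind of edge only. -/
theorem eq_of_opp {g : TetEdge → ℝ} (hg : ∀ e : TetEdge, g e.opp = g e) (e : TetEdge) :
    g e = ![g (ofKind 0), g (ofKind 1), g (ofKind 2), g (ofKind 2)] e.kind := by
  have key : ∀ e : TetEdge, ∃ c : Fin 4, (e = ofKind c ∨ e = (ofKind c).opp) ∧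
      c = (![0, 1, 2, 2] : Fin 4 → Fin 4) e.kind := by decide
  obtain ⟨c, h, hc⟩ := key e
  have h1 : g e = g (ofKind c) := by
    rcases h with h | h
    · rw [h]
    · rw [h, hg]
  rw [h1, hc]
  generalize e.kind = k
  fin_cases k <;> rfl

/-- The angle structures on a layered solid torus, with the exterior angles `a, b, c` at the boundary
edges. -/
theorem exists_isAngleStructure_iff (hn : 0 < n) (d : ℕ → Bool) {a b c : ℝ}
    (habc : a + b + c = Real.pi) (ha : a < Real.pi) (hb : b < Real.pi) (hc : 0 < c)
    (hc' : c < Real.pi) :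
    (∃ α : Fin n → TetEdge → ℝ, (triangulation n d).IsAngleStructure α ∧
      (triangulation n d).angleSum α ((triangulation n d).edge ⟨0, hn⟩ (ofKind 0)) = Real.pi - a ∧
      (triangulation n d).angleSum α ((triangulation n d).edge ⟨0, hn⟩ (ofKind 1)) = Real.pi - b ∧
      (triangulation n d).angleSum α ((triangulation n d).edge ⟨0, hn⟩ (ofKind 2)) = Real.pi - c) ↔
    2 * Real.pi < slopeSum n d a b c := by
  constructor
  · rintro ⟨α, hα, h0, h1, h2⟩
    -- Extended by `0` past the last tetrahedron, to obtain sequences indexed by the natural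
    -- numbers.
    set g : Fin 4 → ℕ → ℝ := fun c k => if h : k < n then α ⟨k, h⟩ (ofKind c) else 0 with hg
    have hgα : ∀ (t : Fin n) (c : Fin 4), g c t = α t (ofKind c) := fun t c => by simp [hg]
    have hα' : ∀ (t : Fin n) e, α t e = ![g 0 t, g 1 t, g 2 t, g 2 t] e.kind := by
      intro t e
      simp only [hgα]
      exact eq_of_opp (hα.opp t) e
    rw [angleSum_eq hα'] at h0 h1 h2
    have hbal : IsBalanced n d (g 0) (g 1) (g 2) a b c := by
      refine ⟨h0, h1, h2, fun k hk => ?_⟩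
      have hl : label n d k (ofKind 3).kind = k + 3 := by
        rw [kind_ofKind]; simp [label, hk]
      have := hα.interior ((triangulation n d).edge ⟨k, by omega⟩ (ofKind 3))
        (by rw [isBoundaryEdge_iff, hl]; omega)
      rw [angleSum_eq hα', hl] at this
      exact this
    have hpos : ∀ (c : Fin 4), ∀ k < n, 0 < g c k := by
      intro c k hk
      rw [hgα ⟨k, hk⟩]
      exact hα.pos _ _
    have hple := hbal.isPleating hn (hpos 0) (hpos 1) (hpos 2) (by
      intro k hk
      rw [← hα.vertex ⟨k, hk⟩ 0]
      simp only [hα']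
      rw [vertex_sum_eq _ rfl]
      rfl) habc
    obtain ⟨k, rfl⟩ : ∃ k, n = k + 1 := ⟨n - 1, by omega⟩
    exact hple.two_pi_lt
  · intro h
    obtain ⟨x, y, A, B, C, hple, rfl, rfl, rfl⟩ :
        ∃ x y A B C : ℕ → ℝ, IsPleating n d x y A B C ∧ A 0 = a ∧ B 0 = b ∧ C 0 = c := by
      obtain ⟨k, rfl⟩ : ∃ k, n = k + 1 := ⟨n - 1, by omega⟩
      exact exists_isPleating k d a b c habc ha hb hc hc' h
    have hbal := hple.isBalanced hn
    set z : ℕ → ℝ := fun k => Real.pi - C k with hz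
    set α : Fin n → TetEdge → ℝ := fun t e => ![x t, y t, z t, z t] e.kind with hα
    have hα' : ∀ (t : Fin n) e, α t e = ![x t, y t, z t, z t] e.kind := fun _ _ => rfl
    have hsum : ∀ t : Fin n, 0 < x t ∧ 0 < y t ∧ 0 < z t ∧ x t + y t + z t = Real.pi := by
      intro t
      have h1 := hple.x_add_y t t.2
      have h2 := hple.lt_pi t t.2
      exact ⟨hple.x_pos t t.2, hple.y_pos t t.2, by simp only [hz]; linarith,
        by simp only [hz]; linarith⟩
    refine ⟨α, ⟨?_, ?_, ?_, ?_, ?_⟩, ?_, ?_, ?_⟩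
    · intro t e
      have key : ∀ i j : Fin 4, (i = j ∧ j < 2) ∨ (i = 3 ∧ j = 2) ∨ (i = 2 ∧ j = 3) →
          ![x t, y t, z t, z t] i = ![x t, y t, z t, z t] j := by
        rintro i j (⟨rfl, -⟩ | ⟨rfl, rfl⟩ | ⟨rfl, rfl⟩) <;> rfl
      exact key _ _ (kind_opp e)
    · intro t e
      obtain ⟨h1, h2, h3, -⟩ := hsum t
      rw [hα']
      generalize e.kind = k
      fin_cases k <;> assumption
    · intro t e
      obtain ⟨h1, h2, h3, h4⟩ := hsum t
      rw [hα']
      generalize e.kind = k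
      fin_cases k <;> simp <;> linarith
    · intro t v
      simp only [hα']
      rw [vertex_sum_eq _ rfl]
      exact (hsum t).2.2.2
    · intro E hE
      obtain ⟨⟨t, e⟩, rfl⟩ := Quot.exists_rep E
      change ¬ (triangulation n d).IsBoundaryEdge ((triangulation n d).edge t e) at hE
      change (triangulation n d).angleSum α ((triangulation n d).edge t e) = _
      rw [isBoundaryEdge_iff] at hE
      rw [angleSum_eq hα']
      obtain ⟨i, hi, hl⟩ := (label_lt_or (n := n) (d := d) t.2 e.kind).resolve_left hE
      rw [hl]
      exact hbal.eq_interior i hi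
    · rw [angleSum_eq hα']; exact hbal.eq_zero
    · rw [angleSum_eq hα']; exact hbal.eq_one
    · rw [angleSum_eq hα']; exact hbal.eq_two

/-! ### Boundary edges, their slopes, and the conclusion -/

variable {p q r m : Slope}

theorem ofVec_pos_sub (γ : FareyPath {p, q, r} m) (k : ℕ) {i j : Fin 4} (hij : i ≠ j) {e : TetEdge}
    (he : e.1 = {i, j}) :
    ofVec (pos p q r γ k j - pos p q r γ k i) =
    ![ofVec (frame p q r γ k).1, ofVec (frame p q r γ k).2,
      ofVec ((frame p q r γ k).1 - (frame p q r γ k).2),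
      ofVec ((frame p q r γ k).1 + (frame p q r γ k).2)] e.kind := by
  -- The table gives the kind of the edge joining vertices `i` and `j`; its diagonal entries are
  -- placeholders.
  have key : ∀ (i j : Fin 4) (e : TetEdge), i ≠ j → e.1 = {i, j} →
      e.kind = (![![0, 0, 3, 1], ![0, 0, 1, 2], ![3, 1, 0, 0], ![1, 2, 0, 0]] :
        Fin 4 → Fin 4 → Fin 4) i j := by decide
  rw [key i j e hij he]
  unfold pos
  generalize frame p q r γ k = b
  obtain ⟨u, w⟩ := b
  have h : ∀ a b : ℤ × ℤ, a = b ∨ a = -b → ofVec a = ofVec b := by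
    rintro a b (rfl | rfl)
    · rfl
    · exact ofVec_neg b
  fin_cases i <;> fin_cases j <;> first
    | exact absurd rfl hij
    | (refine h _ _ (Or.inl ?_); simp; done)
    | (refine h _ _ (Or.inr ?_); simp)

/-- The slopes `p, q, r` are distinct, so the slope of a boundary edge determines its kind in the
first tetrahedron, and edges of one kind there form a single class. The repeated `r` is a
placeholder for the kind `3`. -/
theorem hasBoundaryAngle_iff (hpqr : IsFareyTriangle {p, q, r}) (γ : FareyPath {p, q, r} m)
    (hn : 0 < γ.length - 1) (α : Fin (γ.length - 1) → TetEdge → ℝ) {c : Fin 4} (hc : c ≠ 3) (a : ℝ) :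
    HasBoundaryAngle p q r γ α (![p, q, r, r] c) a ↔
    (layeredSolidTorus p q r γ).angleSum α
      ((layeredSolidTorus p q r γ).edge ⟨0, hn⟩ (ofKind c)) = a := by
  obtain ⟨h1, h2, h3, hb⟩ := frame_zero_spec hpqr γ
  have h1' : ofVec (frame p q r γ 0).1 = p := by rw [h1, ofVec_vec]
  have hpq := hb.ofVec_ne
  have hpr := hb.sub_right.ofVec_ne
  have hqr := hb.sub_left.ofVec_ne
  rw [h1', h2] at hpq
  rw [h1', h3] at hpr
  rw [h3, h2] at hqr
  have hinj : ∀ c c' : Fin 4, c ≠ 3 → c' ≠ 3 →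
      (![p, q, r, r] : Fin 4 → Slope) c = (![p, q, r, r] : Fin 4 → Slope) c' → c = c' := by
    intro c c' hc hc' h
    fin_cases c <;> fin_cases c' <;> simp [hpq, hpr, hqr, hpq.symm, hpr.symm, hqr.symm] at hc hc' h ⊢
  have hslope : ∀ (i j : Fin 4) (e : TetEdge), i ≠ j → e.1 = {i, j} → e.kind ≠ 3 →
      ofVec (pos p q r γ 0 j - pos p q r γ 0 i) = (![p, q, r, r] : Fin 4 → Slope) e.kind := by
    intro i j e hij he hk
    rw [ofVec_pos_sub γ 0 hij he, h1', h2, h3]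
    generalize e.kind = k at hk
    fin_cases k <;> first | rfl | exact absurd rfl hk
  have key1 : ∀ (f : Fin 4) (e : TetEdge), f = 0 ∨ f = 2 → f ∉ e.1 → e.kind ≠ 3 := by decide
  have key2 : ∀ c : Fin 4, c ≠ 3 → ∃ f : Fin 4, (f = 0 ∨ f = 2) ∧ f ∉ (ofKind c).1 := by decide
  constructor
  · intro h
    obtain ⟨f, hf2, hf⟩ := key2 c hc
    refine h ⟨0, hn⟩ (ofKind c) f hf ((glue_eq_none_iff _ f).2 ⟨rfl, hf2⟩) ?_
    obtain ⟨i, j, hij, he⟩ := Finset.card_eq_two.1 (ofKind c).2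
    refine ⟨i, j, hij, he, ?_⟩
    have := hslope i j _ hij he (by rwa [kind_ofKind])
    rwa [kind_ofKind] at this
  · rintro h ⟨t, ht⟩ e f hf hg ⟨i, j, hij, he, hs⟩
    obtain ⟨h0, hf2⟩ := (glue_eq_none_iff _ f).1 hg
    simp only at h0
    subst h0
    have hk := key1 f e hf2 hf
    have hke : e.kind = c := hinj _ _ hk hc ((hslope i j e hij he hk).symm.trans hs)
    rw [← h, ← hke]
    exact congrArg _ (edge_eq_ofKind _ e)

end LayeredSolidTorus

open LayeredSolidTorus in
theorem mainTheorem6 (p q r m : Slope) (hpqr : IsFareyTriangle {p, q, r})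
    (γ : FareyPath {p, q, r} m) (hN : 2 ≤ γ.length)
    (hr : r ∉ γ.tri 1) (hp : p ∉ γ.tri 2)
    (θp θq θr : ℝ) (hsum : θp + θq + θr = Real.pi)
    (hθp : -Real.pi < θp ∧ θp < Real.pi) (hθq : -Real.pi < θq ∧ θq < Real.pi)
    (hθr : 0 < θr ∧ θr < Real.pi) :
    (∃ α : Fin (γ.length - 1) → TetEdge → ℝ,
      (layeredSolidTorus p q r γ).IsAngleStructure α ∧
      HasBoundaryAngle p q r γ α p (Real.pi - θp) ∧
      HasBoundaryAngle p q r γ α q (Real.pi - θq) ∧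
      HasBoundaryAngle p q r γ α r (Real.pi - θr)) ↔
    2 * Real.pi < Slope.inter m p * θp + Slope.inter m q * θq + Slope.inter m r * θr := by
  have hn : 0 < γ.length - 1 := by omega
  obtain ⟨h1, h2, h3⟩ := inter_meridian hpqr γ (by omega) hr
  have h := exists_isAngleStructure_iff hn (dropsU p q r γ) hsum hθp.2 hθq.2 hθr.1 hθr.2
  have hP := fun α => hasBoundaryAngle_iff hpqr γ hn α (c := 0) (by decide) (Real.pi - θp)
  have hQ := fun α => hasBoundaryAngle_iff hpqr γ hn α (c := 1) (by decide) (Real.pi - θq)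
  have hR := fun α => hasBoundaryAngle_iff hpqr γ hn α (c := 2) (by decide) (Real.pi - θr)
  simp only [Matrix.cons_val] at hP hQ hR
  simp only [hP, hQ, hR]
  -- In terms of the weights, the right-hand side becomes `slopeSum`.
  rw [h1, h2, h3]
  push_cast
  exact h
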